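/- Throughout, $\log$ is the logarithm to base $2$, $\ln$ the natural logarithm, $a\vee b=\max\{a,b\}$, and $H(q)=-\sum_i q_i\log q_i$ (with $0\log 0=0$). **Setting.** Let $\mathbb X\subseteq\mathbb R$ and let $W$ be a channel with input alphabet $\mathbb X$ and output alphabet $\mathbb N_0$, i.e. $W(i|x)\ge 0$ and $\sum_{i\ge0}W(i|x)=1$ for all $x\in\mathbb X$. For an integer $M\ge1$ let $W_M(i|x)=W(i|x)+\frac1M\sum_{j\ge M}W(j|x)$, $0\le i\le M-1$, be its $M$-truncation. Let $\mathbb A=[a,b]\subseteq\mathbb X$ with $a<b$, and $\rho=b-a$. Assume that * every map $x\mapsto W(i|x)$ is Lipschitz on $\mathbb X$ with one constant $L$; * $\gamma_M:=\min_{0\le i<M}\min_{x\in\mathbb A}W_M(i|x)>0$; * the cost function $s:\mathbb X\to\mathbb R$ is Lipschitz with constant $L_s$, and $\min_{\mathbb A}s<S<\max_{\mathbb A}s$. Let $\mathcal D(\mathbb A)$ be the set of probability densities on $\mathbb A$; call $p\in\mathcal D(\mathbb A)$ feasible if $\int_{\mathbb A}p\,s\,dx=S$. For a density $p$ put $q^p_i=\int_{\mathbb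 A}W_M(i|x)p(x)\,dx$ and $I(p,W_M)=\int_{\mathbb A}\sum_{i}W_M(i|x)\log\frac{W_M(i|x)}{q^p_i}\,p(x)\,dx$. For $\lambda\in\mathbb R^M$ put $f_\lambda(x)=\sum_i W_M(i|x)\lambda_i-H(W_M(\cdot|x))$ (coordinates indexed by $i=0,\dots,M-1$), $$F(\lambda)=\max_{q\in\Delta_M}\{H(q)-\lambda^\top q\},\qquad G(\lambda)=\sup_{p\text{ feasible}}\int_{\mathbb A}p f_\lambda\,dx,$$ and for $\nu>0$ $$G_\nu(\lambda)=\sup_{p\text{ feasible}}\Big\{\int_{\mathbb A}pf_\lambda\,dx-\nu\int_{\mathbb A}p\log p\,dx-\nu\log\rho\Big\}.$$ Let $p_\nu^\lambda(x)=2^{\mu_1+\frac1\nu f_\lambda(x)+\mu_2s(x)}$ with $\mu_1,\mu_2\in\mathbb R$ chosen such that $p_\nu^\lambda$ is a feasible density. **Algorithm.** Let $Q=\{\lambda\in\mathbb R^M:\|\lambda\|_2\le M(\log\frac1{\gamma_M}\vee\frac1{\ln2})\}$, let $\pi_Q$ be the Euclidean projection onto $Q$, $L_\nu=1+\frac1\nu$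 and $g=\nabla F+\nabla G_\nu$. Choose any $x_0\in Q$ and for $k\ge0$ set $$y_k=\pi_Q\big(x_k-\tfrac1{L_\nu}g(x_k)\big),\quad z_k=\pi_Q\Big(-\tfrac1{L_\nu}\sum_{i=0}^k\tfrac{i+1}2g(x_i)\Big),\quad x_{k+1}=\tfrac2{k+3}z_k+\tfrac{k+1}{k+3}y_k .$$ After $n$ iterations let $\hat\lambda=y_n$ and $\hat p=\sum_{k=0}^n\frac{2(k+1)}{(n+1)(n+2)}p_\nu^{x_k}$. **Constants.** $D_1=\frac12\big(M\log\frac1{\gamma_M}\vee\frac1{\ln2}\big)^2$, $L_f=LM^2(\log\frac1{\gamma_M}\vee\frac1{\ln2})+ML\,|\log\frac1{\gamma_M}-\frac1{\ln2}|$, $\underline s=-S+\min_{\mathbb A}s$, $\overline s=-S+\max_{\mathbb A}s$, $$T_1=L_f\rho+2L_fL_s\rho^2\Big(\tfrac1{-\underline s}\vee\tfrac1{\overline s}\Big),\qquad T_2=L_s\rho\Big(\tfrac2{-\underline s}\log\big(\tfrac{2L_s\rho}{-\underline s}\vee1\big)\vee\tfrac2{\overline s}\log\big(\tfrac{2L_s\rho}{\overline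 s}\vee1\big)\Big),$$ and $\alpha=2(T_1+T_2+1)$. **Theorem.** For all $\nu>0$ and $\lambda\in\mathbb R^M$, numbers $\mu_1,\mu_2$ as required for $p^\lambda_\nu$ exist. Let $0<\varepsilon<\frac\alpha4$, $\nu=\dfrac{\varepsilon/\alpha}{\log(\alpha/\varepsilon)}$ and $$n\ \ge\ \tfrac1\varepsilon\sqrt{8D_1\alpha}\,\sqrt{\log(\varepsilon^{-1})+\log\alpha+\tfrac14}.$$ Then, for every starting point $x_0\in Q$, $\hat\lambda\in Q$, $\hat p$ is a feasible density, and $$0\le F(\hat\lambda)+G(\hat\lambda)-I(\hat p,W_M)\le\varepsilon .$$ Moreover $F(\hat\lambda)+G(\hat\lambda)\le F(\lambda)+G(\lambda)+\varepsilon$ for all $\lambda\in\mathbb R^M$ and $I(p,W_M)\le I(\hat p,W_M)+\varepsilon$ for all feasible densities $p$; we then call $(\hat\lambda,\hat p)$ an $\varepsilon$-solution. Consequently there are numbers $N(\varepsilon)\in\mathbb N_0$ with $N(\varepsilon)=O\big(\frac1\varepsilon\sqrt{\log(\varepsilon^{-1})}\big)$ as $\varepsilon\downarrow0$ such that for every $\varepsilon\in(0,\frac\alpha4)$,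 with $\nu$ as above, $N(\varepsilon)$ iterations from any $x_0\in Q$ give an $\varepsilon$-solution. -/

import Mathlib

open MeasureTheory Asymptotics
open scoped NNReal Topology Gradient

namespace ChannelCapacity

noncomputable section

/-- `W i x = W(i|x)` is a channel with input alphabet `X ⊆ ℝ` and output alphabet `ℕ`. -/
def IsChannel (X : Set ℝ) (W : ℕ → ℝ → ℝ) : Prop :=
  (∀ x ∈ X, ∀ i, 0 ≤ W i x) ∧ ∀ x ∈ X, HasSum (fun i => W i x) 1

/-- The `M`-truncated channel: the mass of the outputs `j ≥ M` is spread uniformly over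
`{0, …, M - 1}`. -/
def truncate (W : ℕ → ℝ → ℝ) (M : ℕ) : Fin M → ℝ → ℝ :=
  fun i x => W i x + (1 / (M : ℝ)) * ∑' j : ℕ, W (j + M) x

variable {M : ℕ}

/-- The smallest transition probability over the inputs in `A`. -/
def minProb (V : Fin M → ℝ → ℝ) (A : Set ℝ) : ℝ :=
  sInf {t | ∃ i : Fin M, ∃ x ∈ A, t = V i x}

/-- Shannon entropy in bits. -/
def entropy (q : Fin M → ℝ) : ℝ := ∑ i, -(q i * Real.logb 2 (q i))

/-- Relative entropy in bits. -/
def relEntropy (p q : Fin M → ℝ) : ℝ := ∑ i, p i * Real.logb 2 (p i / q i)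

/-- Probability densities on `A` (with respect to Lebesgue measure). -/
def IsDensity (A : Set ℝ) (p : ℝ → ℝ) : Prop :=
  IntegrableOn p A ∧ (∀ᵐ x ∂(volume.restrict A), 0 ≤ p x) ∧ ∫ x in A, p x = 1

/-- Densities on `A` that meet the average-cost constraint `⟨p, s⟩ = S`. -/
def IsFeasible (A : Set ℝ) (s : ℝ → ℝ) (S : ℝ) (p : ℝ → ℝ) : Prop :=
  IsDensity A p ∧ ∫ x in A, p x * s x = S

/-- Differential entropy in bits. -/
def diffEntropy (A : Set ℝ) (p : ℝ → ℝ) : ℝ := -∫ x in A, p x * Real.logb 2 (p x)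

/-- The output distribution induced by the input density `p`. -/
def outputDist (V : Fin M → ℝ → ℝ) (A : Set ℝ) (p : ℝ → ℝ) : Fin M → ℝ :=
  fun i => ∫ x in A, V i x * p x

/-- Mutual information `I(p, V) = ∫_A D(V(·|x) ‖ pV) p(x) dx`. -/
def mutualInfo (V : Fin M → ℝ → ℝ) (A : Set ℝ) (p : ℝ → ℝ) : ℝ :=
  ∫ x in A, relEntropy (fun i => V i x) (outputDist V A p) * p x

/-- `f_l(x) = ∑ i, V(i|x) l i - r(x)`, where `r(x)` is the entropy of `V(·|x)`. -/
def payoff (V : Fin M → ℝ → ℝ) (l : EuclideanSpace ℝ (Fin M)) (x : ℝ) : ℝ :=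
  ∑ i, V i x * l i - entropy (fun i => V i x)

/-- `F(l) = max {H(q) - ⟨l, q⟩ : q in the simplex}`. -/
def dualF (l : EuclideanSpace ℝ (Fin M)) : ℝ :=
  sSup {t | ∃ q ∈ stdSimplex ℝ (Fin M), t = entropy q - ∑ i, l i * q i}

/-- `G(l) = sup {⟨p, f_l⟩ : p a density on A, ⟨p, s⟩ = S}`. -/
def dualG (V : Fin M → ℝ → ℝ) (A : Set ℝ) (s : ℝ → ℝ) (S : ℝ)
    (l : EuclideanSpace ℝ (Fin M)) : ℝ :=
  sSup {t | ∃ p, IsFeasible A s S p ∧ t = ∫ x in A, p x * payoff V l x}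

/-- The smoothed function `G_ν`. Densities whose differential entropy is `-∞`, which do not
contribute to the supremum, are left out. -/
def smoothG (V : Fin M → ℝ → ℝ) (A : Set ℝ) (s : ℝ → ℝ) (S ν : ℝ)
    (l : EuclideanSpace ℝ (Fin M)) : ℝ :=
  sSup {t | ∃ p, IsFeasible A s S p ∧ IntegrableOn (fun x => p x * Real.logb 2 (p x)) A ∧
    t = (∫ x in A, p x * payoff V l x) + ν * diffEntropy A p
      - ν * Real.logb 2 (volume.real A)}

/-- `2 ^ (μ₁ + f_l(x) / ν + μ₂ s(x))`. -/
def gibbs (V : Fin M → ℝ → ℝ) (s : ℝ → ℝ) (ν : ℝ) (l : EuclideanSpace ℝ (Fin M))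
    (μ : ℝ × ℝ) (x : ℝ) : ℝ :=
  (2 : ℝ) ^ (μ.1 + (1 / ν) * payoff V l x + μ.2 * s x)

open Classical in
/-- The analytical optimizer `p_ν^l` of `G_ν(l)`: the function `gibbs` with `μ₁, μ₂` chosen so
that it is a density that meets the cost constraint. -/
def optDensity (V : Fin M → ℝ → ℝ) (A : Set ℝ) (s : ℝ → ℝ) (S ν : ℝ)
    (l : EuclideanSpace ℝ (Fin M)) : ℝ → ℝ :=
  if h : ∃ μ : ℝ × ℝ, IsFeasible A s S (gibbs V s ν l μ) then gibbs V s ν l h.choose else 0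

/-- Projection onto the Euclidean ball of radius `R` around the origin. -/
def ballProj (R : ℝ) (x : EuclideanSpace ℝ (Fin M)) : EuclideanSpace ℝ (Fin M) :=
  if R < ‖x‖ then (R / ‖x‖) • x else x

/-- Step 2 of the fast gradient method, for the gradient field `g`. -/
def stepY (R L : ℝ) (g : EuclideanSpace ℝ (Fin M) → EuclideanSpace ℝ (Fin M))
    (x : EuclideanSpace ℝ (Fin M)) : EuclideanSpace ℝ (Fin M) :=
  ballProj R (-(1 / L) • g x + x)

/-- Fast gradient method on the ball of radius `R`: the pair of the iterate `x k` and the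
weighted sum `∑ i < k, ((i + 1) / 2) • g (x i)` of the previous gradients. -/
def fastGradient (R L : ℝ) (g : EuclideanSpace ℝ (Fin M) → EuclideanSpace ℝ (Fin M))
    (x₀ : EuclideanSpace ℝ (Fin M)) :
    ℕ → EuclideanSpace ℝ (Fin M) × EuclideanSpace ℝ (Fin M)
  | 0 => (x₀, 0)
  | k + 1 =>
    let x := (fastGradient R L g x₀ k).1
    let w := (fastGradient R L g x₀ k).2 + (((k : ℝ) + 1) / 2) • g x
    let y := stepY R L g x
    let z := ballProj R (-(1 / L) • w)
    ((2 / ((k : ℝ) + 3)) • z + (((k : ℝ) + 1) / ((k : ℝ) + 3)) • y, w)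

/-- The radius of the dual feasible set `Q`. -/
def dualRadius (V : Fin M → ℝ → ℝ) (A : Set ℝ) : ℝ :=
  M * max (Real.logb 2 (minProb V A)⁻¹) (1 / Real.log 2)

/-- The dual feasible set `Q`. -/
def dualSet (V : Fin M → ℝ → ℝ) (A : Set ℝ) : Set (EuclideanSpace ℝ (Fin M)) :=
  {l | ‖l‖ ≤ dualRadius V A}

/-- The iterate `x_k` of the fast gradient method for the minimization of `F + G_ν` over `Q`,
with step parameter `1 + 1 / ν`. -/
def iterX (V : Fin M → ℝ → ℝ) (A : Set ℝ) (s : ℝ → ℝ) (S ν : ℝ)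
    (x₀ : EuclideanSpace ℝ (Fin M)) (k : ℕ) : EuclideanSpace ℝ (Fin M) :=
  (fastGradient (dualRadius V A) (1 + 1 / ν)
    (fun l => ∇ dualF l + ∇ (smoothG V A s S ν) l) x₀ k).1

/-- The dual approximate solution `y_n`. -/
def dualApprox (V : Fin M → ℝ → ℝ) (A : Set ℝ) (s : ℝ → ℝ) (S ν : ℝ)
    (x₀ : EuclideanSpace ℝ (Fin M)) (n : ℕ) : EuclideanSpace ℝ (Fin M) :=
  stepY (dualRadius V A) (1 + 1 / ν)
    (fun l => ∇ dualF l + ∇ (smoothG V A s S ν) l) (iterX V A s S ν x₀ n)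

/-- The primal approximate solution, a weighted average of the `p_ν^{x_k}`. -/
def primalApprox (V : Fin M → ℝ → ℝ) (A : Set ℝ) (s : ℝ → ℝ) (S ν : ℝ)
    (x₀ : EuclideanSpace ℝ (Fin M)) (n : ℕ) (x : ℝ) : ℝ :=
  ∑ k ∈ Finset.range (n + 1),
    2 * ((k : ℝ) + 1) / (((n : ℝ) + 1) * ((n : ℝ) + 2)) *
      optDensity V A s S ν (iterX V A s S ν x₀ k) x

/-- `(l, p)` is an `ε`-solution of the dual and primal problems: both are feasible, the
primal-dual gap lies in `[0, ε]`, and each is optimal for its problem up to `ε`. -/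
def IsEpsSolution (V : Fin M → ℝ → ℝ) (A : Set ℝ) (s : ℝ → ℝ) (S ε : ℝ)
    (l : EuclideanSpace ℝ (Fin M)) (p : ℝ → ℝ) : Prop :=
  l ∈ dualSet V A ∧ IsFeasible A s S p ∧
  0 ≤ dualF l + dualG V A s S l - mutualInfo V A p ∧
  dualF l + dualG V A s S l - mutualInfo V A p ≤ ε ∧
  (∀ l', dualF l + dualG V A s S l ≤ dualF l' + dualG V A s S l' + ε) ∧
  ∀ p', IsFeasible A s S p' → mutualInfo V A p' ≤ mutualInfo V A p + ε

/-- `D₁`. -/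
def constD₁ (V : Fin M → ℝ → ℝ) (A : Set ℝ) : ℝ :=
  (1 / 2) * (max (M * Real.logb 2 (minProb V A)⁻¹) (1 / Real.log 2)) ^ 2

/-- The constant `L_f`, for channel maps with Lipschitz constant `L`. -/
def constLf (V : Fin M → ℝ → ℝ) (A : Set ℝ) (L : ℝ) : ℝ :=
  L * (M : ℝ) ^ 2 * max (Real.logb 2 (minProb V A)⁻¹) (1 / Real.log 2)
    + M * L * |Real.logb 2 (minProb V A)⁻¹ - 1 / Real.log 2|

/-- `-S + min_A s`. -/
def sLow (A : Set ℝ) (s : ℝ → ℝ) (S : ℝ) : ℝ := -S + sInf (s '' A)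

/-- `-S + max_A s`. -/
def sHigh (A : Set ℝ) (s : ℝ → ℝ) (S : ℝ) : ℝ := -S + sSup (s '' A)

/-- `T₁`. -/
def constT₁ (V : Fin M → ℝ → ℝ) (A : Set ℝ) (s : ℝ → ℝ) (S L Ls : ℝ) : ℝ :=
  constLf V A L * volume.real A
    + 2 * constLf V A L * Ls * (volume.real A) ^ 2 * max (1 / -sLow A s S) (1 / sHigh A s S)

/-- `T₂`. -/
def constT₂ (A : Set ℝ) (s : ℝ → ℝ) (S Ls : ℝ) : ℝ :=
  Ls * volume.real A * max
    (2 / -sLow A s S * Real.logb 2 (max (2 * Ls * volume.real A / -sLow A s S) 1))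
    (2 / sHigh A s S * Real.logb 2 (max (2 * Ls * volume.real A / sHigh A s S) 1))

/-- `α = 2 (T₁ + T₂ + 1)`. -/
def constα (V : Fin M → ℝ → ℝ) (A : Set ℝ) (s : ℝ → ℝ) (S L Ls : ℝ) : ℝ :=
  2 * (constT₁ V A s S L Ls + constT₂ A s S Ls + 1)

/-- The smoothing parameter `ν = (ε / α) / log (α / ε)`. -/
def smoothing (α ε : ℝ) : ℝ := (ε / α) / Real.logb 2 (α / ε)

/-- The number of iterations prescribed for the accuracy `ε`. -/
def iterBound (D₁ α ε : ℝ) : ℝ :=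
  (1 / ε) * √(8 * D₁ * α) * √(Real.logb 2 ε⁻¹ + Real.logb 2 α + 1 / 4)

end

end ChannelCapacity

open ChannelCapacity

namespace ChannelCapacity

/-! For a feasible density `p` with output distribution `q`, the mean payoff at the multiplier `u =
-log q` is exactly the mutual information. At any other multiplier the terms `⟨l, q⟩` of the two
dual functions cancel, so `F + G` is at least the mutual information of every feasible density. It
therefore suffices to bound the gap by `ε`; near-optimality in both problems follows from weak
duality.

Smoothing. `F` and `G_ν` are suprema of functions affine in the multiplier, perturbed by an entropy.
Their optimizers are Gibbs laws. The Gibbs variational inequality and Hoeffding's lemma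
(`integral_mul_le_add_relEntropy`) show that such an optimizer remains optimal at a nearby
multiplier up to a quadratic error. This yields both the gradients and the constants `1` and `1 / ν`
(`dualF_bounds`, `smoothG_bounds`).

Optimization. The estimate sequence (`fastGradient_estimate`) bounds `F + G_ν` at `y_n` by the
weighted linearizations at the iterates, evaluated at any point of `Q`. The point taken is `u = -log
q`, with `q` the output of the averaged density `p̂`. There the linearization of `F` is minus a
relative entropy, and that of `G_ν` is at most the mean of `f_u` under the optimizer, since the
uniform density has maximal entropy. Averaging gives the mean of `f_u` under `p̂`, which is the
mutual information of `p̂`. The bound on `‖u‖` leaves slack in `D₁` that pays for an arbitrary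
starting point (`start_error_le`).

Smoothing error. The exponent of the Gibbs density is Lipschitz, so its maximum is at most the
log-partition function plus a logarithmic term (`mul_exp_le_integral_exp`). The Lipschitz constant
involves the multiplier of the cost constraint, which is bounded because a strong tilt would push
the mean cost past `S` (`tilt_mul_le`). This gives `G ≤ G_ν + ν log (1 + ln 2 (T₁ / ν + T₂))`
(`dualG_le_smoothG_add`). The choice of `ν` makes this error and the optimization error at most `ε /
2` each. -/

variable {M : ℕ}

/-! ### Hoeffding's lemma and the Gibbs variational inequality -/

/-- Hoeffding's lemma for a random variable with values in `[-B, B]`. -/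
theorem integral_exp_le_of_abs_le {Ω : Type*} [MeasurableSpace Ω] {P : Measure Ω}
    [IsProbabilityMeasure P] {h : Ω → ℝ} (hm : AEMeasurable h P) {B : ℝ} (hB0 : 0 ≤ B)
    (hB : ∀ᵐ x ∂P, |h x| ≤ B) :
    ∫ x, Real.exp (h x) ∂P ≤ Real.exp ((∫ x, h x ∂P) + B ^ 2 / 2) := by
  have hmem : ∀ᵐ x ∂P, h x ∈ Set.Icc (-B) B := by
    filter_upwards [hB] with x hx using abs_le.mp hx
  have key := (ProbabilityTheory.hasSubgaussianMGF_of_mem_Icc hm hmem).mgf_le 1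
  have hc : (((‖B - -B‖₊ / 2) ^ 2 : ℝ≥0) : ℝ) = B ^ 2 := by
    push_cast
    rw [Real.norm_of_nonneg (by linarith)]
    ring
  rw [hc, ProbabilityTheory.mgf] at key
  have hsplit : ∀ x, Real.exp (1 * (h x - ∫ y, h y ∂P))
      = Real.exp (h x) * Real.exp (-(∫ y, h y ∂P)) := fun x => by
    rw [← Real.exp_add]; ring_nf
  simp only [hsplit, integral_mul_const] at key
  rw [Real.exp_neg, ← div_eq_mul_inv, div_le_iff₀ (Real.exp_pos _)] at key
  rw [Real.exp_add, mul_comm]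
  simpa using key

/-- The Gibbs variational inequality combined with Hoeffding's lemma: changing the density from
`p₀` to `p` moves the mean of a function bounded by `B` by at most the relative entropy plus
`B ^ 2 / 2`. -/
theorem integral_mul_le_add_relEntropy {Ω : Type*} [MeasurableSpace Ω] {m : Measure Ω}
    {p₀ p h : Ω → ℝ} (hp₀i : Integrable p₀ m) (hp₀ : ∀ᵐ x ∂m, 0 < p₀ x) (hp₀1 : ∫ x, p₀ x ∂m = 1)
    (hpi : Integrable p m) (hp : ∀ᵐ x ∂m, 0 ≤ p x) (hp1 : ∫ x, p x ∂m = 1)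
    (hpp : Integrable (fun x => p x * Real.log (p x)) m)
    (hpp₀ : Integrable (fun x => p x * Real.log (p₀ x)) m)
    (hm : AEStronglyMeasurable h m) {B : ℝ} (hB0 : 0 ≤ B) (hB : ∀ᵐ x ∂m, |h x| ≤ B) :
    ∫ x, p x * h x ∂m ≤ (∫ x, p₀ x * h x ∂m)
      + ((∫ x, p x * Real.log (p x) ∂m) - ∫ x, p x * Real.log (p₀ x) ∂m) + B ^ 2 / 2 := by
  have hdens : AEMeasurable (fun x => ENNReal.ofReal (p₀ x)) m :=
    hp₀i.aestronglyMeasurable.aemeasurable.ennreal_ofReal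
  set P : Measure Ω := m.withDensity fun x => ENNReal.ofReal (p₀ x) with hP
  have hac : P ≪ m := withDensity_absolutelyContinuous _ _
  have : IsProbabilityMeasure P := by
    refine ⟨?_⟩
    rw [hP, withDensity_apply _ MeasurableSet.univ, Measure.restrict_univ,
      ← ofReal_integral_eq_lintegral_ofReal hp₀i (hp₀.mono fun x hx => hx.le), hp₀1,
      ENNReal.ofReal_one]
  have hint : ∀ g : Ω → ℝ, ∫ x, g x ∂P = ∫ x, p₀ x * g x ∂m := fun g => by
    rw [hP, integral_withDensity_eq_integral_toReal_smul₀ hdens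
      (Filter.Eventually.of_forall fun x => ENNReal.ofReal_lt_top)]
    refine integral_congr_ae ?_
    filter_upwards [hp₀] with x hx
    simp [ENNReal.toReal_ofReal hx.le]
  have hbdd : ∀ {g : Ω → ℝ}, Integrable g m → ∀ {k : Ω → ℝ}, AEStronglyMeasurable k m →
      ∀ C : ℝ, (∀ᵐ x ∂m, |k x| ≤ C) → Integrable (fun x => g x * k x) m := by
    intro g hg k hk C hC
    exact (hg.bdd_mul hk (c := C) hC).congr (Filter.Eventually.of_forall fun x => mul_comm _ _)
  set Z : ℝ := ∫ x, p₀ x * Real.exp (h x) ∂m with hZ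
  have hexpi : Integrable (fun x => p₀ x * Real.exp (h x)) m := by
    refine hbdd hp₀i (Real.continuous_exp.comp_aestronglyMeasurable hm) (Real.exp B) ?_
    filter_upwards [hB] with x hx
    rw [abs_of_pos (Real.exp_pos _)]
    exact Real.exp_le_exp.mpr (abs_le.mp hx).2
  have hZle : Z ≤ Real.exp ((∫ x, p₀ x * h x ∂m) + B ^ 2 / 2) := by
    have := integral_exp_le_of_abs_le (P := P) (hm.aemeasurable.mono_ac hac) hB0 (hac.ae_le hB)
    rwa [hint, hint] at this
  have hZpos : 0 < Z := by
    have h1 : Real.exp (-B) ≤ Z := by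
      rw [hZ]
      calc Real.exp (-B) = ∫ x, p₀ x * Real.exp (-B) ∂m := by rw [integral_mul_const, hp₀1, one_mul]
        _ ≤ _ := by
          refine integral_mono_ae (hp₀i.mul_const _) hexpi ?_
          filter_upwards [hB, hp₀] with x hx hx0
          exact mul_le_mul_of_nonneg_left (Real.exp_le_exp.mpr (abs_le.mp hx).1) hx0.le
    exact (Real.exp_pos _).trans_le h1
  have hph : Integrable (fun x => p x * h x) m := hbdd hpi hm B hB
  -- This is `log t ≤ t - 1` at `t = p₀ exp h / (Z p)`, multiplied by `p`. Where `p` vanishes the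
  -- left side is `0`. The right side integrates to `1 - 1 = 0`.
  have hpoint : ∀ᵐ x ∂m, p x * h x - (p x * Real.log (p x) - p x * Real.log (p₀ x))
      - p x * Real.log Z ≤ p₀ x * Real.exp (h x) / Z - p x := by
    filter_upwards [hp, hp₀] with x hx hx0
    rcases hx.eq_or_lt with h0 | hpos
    · rw [← h0]
      simp only [zero_mul, sub_zero]
      positivity
    · have hy : 0 < p₀ x * Real.exp (h x) / Z / p x := by positivity
      have hlog := Real.log_le_sub_one_of_pos hy
      rw [Real.log_div (by positivity) hpos.ne', Real.log_div (by positivity) hZpos.ne',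
        Real.log_mul hx0.ne' (Real.exp_pos _).ne', Real.log_exp] at hlog
      have := mul_le_mul_of_nonneg_left hlog hpos.le
      have h2 : p x * (p₀ x * Real.exp (h x) / Z / p x - 1) = p₀ x * Real.exp (h x) / Z - p x := by
        field_simp
      rw [h2] at this
      linarith
  have hI := integral_mono_ae ((hph.sub (hpp.sub hpp₀)).sub (hpi.mul_const (Real.log Z)))
    ((hexpi.div_const Z).sub hpi) hpoint
  have e1 : ∫ x, (p₀ x * Real.exp (h x) / Z - p x) ∂m = 0 := by
    rw [integral_sub (hexpi.div_const Z) hpi, integral_div, ← hZ, hp1, div_self hZpos.ne', sub_self]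
  have e2 : ∫ x, (p x * h x - (p x * Real.log (p x) - p x * Real.log (p₀ x))
      - p x * Real.log Z) ∂m = (∫ x, p x * h x ∂m) - ((∫ x, p x * Real.log (p x) ∂m)
        - ∫ x, p x * Real.log (p₀ x) ∂m) - Real.log Z := by
    have hd : Integrable (fun x => p x * Real.log (p x) - p x * Real.log (p₀ x)) m := hpp.sub hpp₀
    have hhd : Integrable (fun x => p x * h x - (p x * Real.log (p x) - p x * Real.log (p₀ x))) m :=
      hph.sub hd
    rw [integral_sub hhd (hpi.mul_const (Real.log Z)), integral_sub hph hd, integral_sub hpp hpp₀, integral_mul_const, hp1, one_mul]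
  have hlogZ : Real.log Z ≤ (∫ x, p₀ x * h x ∂m) + B ^ 2 / 2 := by
    rw [Real.log_le_iff_le_exp hZpos]
    exact hZle
  have hI' : (∫ x, p x * h x ∂m) - ((∫ x, p x * Real.log (p x) ∂m)
        - ∫ x, p x * Real.log (p₀ x) ∂m) - Real.log Z ≤ 0 := by
    rw [← e2, ← e1]
    exact hI
  linarith

/-! ### Gradients from quadratic bounds, and projection onto a ball -/

/-- A function squeezed between an affine function and a quadratic perturbation of it is
differentiable. -/
theorem hasGradientAt_of_quadratic_bound {E : Type*} [NormedAddCommGroup E]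
    [InnerProductSpace ℝ E] [CompleteSpace E] {f : E → ℝ} {v x : E} {C : ℝ}
    (hl : ∀ y, f x + inner ℝ v (y - x) ≤ f y)
    (hu : ∀ y, f y ≤ f x + inner ℝ v (y - x) + C * ‖y - x‖ ^ 2) : HasGradientAt f v x := by
  rw [hasGradientAt_iff_isLittleO]
  have hO : (fun y => f y - f x - inner ℝ v (y - x)) =O[𝓝 x] fun y => ‖y - x‖ ^ 2 := by
    refine IsBigO.of_bound C (Filter.Eventually.of_forall fun y => ?_)
    rw [Real.norm_of_nonneg (by linarith [hl y]), Real.norm_of_nonneg (by positivity)]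
    linarith [hu y]
  refine hO.trans_isLittleO ?_
  have h0 : Filter.Tendsto (fun y : E => ‖y - x‖) (𝓝 x) (𝓝 0) := by
    have : Continuous fun y : E => ‖y - x‖ := by fun_prop
    simpa using this.tendsto x
  have := (isLittleO_one_iff ℝ).mpr h0
  have h2 := this.mul_isBigO (isBigO_refl (fun y : E => ‖y - x‖) (𝓝 x))
  simp only [one_mul, ← pow_two] at h2
  exact h2.norm_right.congr_right (by simp) |>.of_norm_right

theorem norm_ballProj_le {R : ℝ} (hR : 0 ≤ R) (x : EuclideanSpace ℝ (Fin M)) :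
    ‖ballProj R x‖ ≤ R := by
  unfold ballProj
  split_ifs with h
  · have hx : 0 < ‖x‖ := hR.trans_lt h
    rw [norm_smul, Real.norm_of_nonneg (by positivity), div_mul_cancel₀ _ hx.ne']
  · exact not_lt.mp h

/-- The variational characterization of the projection onto a ball. -/
theorem inner_sub_ballProj_nonpos {R : ℝ} (hR : 0 ≤ R) (w : EuclideanSpace ℝ (Fin M))
    {x : EuclideanSpace ℝ (Fin M)} (hx : ‖x‖ ≤ R) :
    inner ℝ (w - ballProj R w) (x - ballProj R w) ≤ 0 := by
  unfold ballProj
  split_ifs with h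
  · have hw : 0 < ‖w‖ := hR.trans_lt h
    have e : w - (R / ‖w‖) • w = (1 - R / ‖w‖) • w := by rw [sub_smul, one_smul]
    have hc : 0 ≤ 1 - R / ‖w‖ := by
      rw [sub_nonneg, div_le_one hw]; exact h.le
    rw [e, real_inner_smul_left, inner_sub_right, real_inner_smul_right,
      real_inner_self_eq_norm_sq]
    refine mul_nonpos_of_nonneg_of_nonpos hc ?_
    have h1 := real_inner_le_norm w x
    have h2 : R / ‖w‖ * ‖w‖ ^ 2 = ‖w‖ * R := by field_simp
    rw [h2]
    nlinarith
  · simp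

/-- The proximal step `ballProj R (x - g / L)` minimizes the quadratic model over the ball, and
the model grows quadratically away from its minimizer. -/
theorem inner_add_sq_ballProj_le {R L c : ℝ} (hR : 0 ≤ R) (hL : 0 < L)
    (x g : EuclideanSpace ℝ (Fin M)) {u : EuclideanSpace ℝ (Fin M)} (hu : ‖u‖ ≤ R)
    (hc : c = 1 / L) :
    inner ℝ g (ballProj R (-c • g + x)) + L / 2 * ‖ballProj R (-c • g + x) - x‖ ^ 2
      + L / 2 * ‖u - ballProj R (-c • g + x)‖ ^ 2
      ≤ inner ℝ g u + L / 2 * ‖u - x‖ ^ 2 := by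
  -- The claim is `L` times this variational inequality, with `‖u - x‖ ^ 2` expanded around the
  -- projected point.
  have key := inner_sub_ballProj_nonpos hR (-c • g + x) hu
  set y := ballProj R (-c • g + x)
  have h1 : inner ℝ (-c • g + x - y) (u - y)
      = -c * inner ℝ g (u - y) + inner ℝ (x - y) (u - y) := by
    rw [show -c • g + x - y = -c • g + (x - y) by abel, inner_add_left, real_inner_smul_left]
  have h2 : ‖u - x‖ ^ 2 = ‖u - y‖ ^ 2 - 2 * inner ℝ (x - y) (u - y) + ‖y - x‖ ^ 2 := by
    rw [show u - x = (u - y) - (x - y) by abel, norm_sub_sq_real, norm_sub_rev y x,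
      real_inner_comm]
  rw [h1] at key
  have h3 : inner ℝ g (u - y) = inner ℝ g u - inner ℝ g y := inner_sub_right _ _ _
  have h4 : L * (-c * inner ℝ g (u - y) + inner ℝ (x - y) (u - y)) ≤ 0 :=
    mul_nonpos_of_nonneg_of_nonpos hL.le key
  have h5 : L * c = 1 := by rw [hc]; field_simp
  have h6 : L * (-c * inner ℝ g (u - y) + inner ℝ (x - y) (u - y))
      = -inner ℝ g (u - y) + L * inner ℝ (x - y) (u - y) := by
    linear_combination (-inner ℝ g (u - y)) * h5
  rw [h6, h3] at h4
  rw [h2]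
  linarith

/-! ### The fast gradient method -/

section FastGradient

variable {R L : ℝ} {g : EuclideanSpace ℝ (Fin M) → EuclideanSpace ℝ (Fin M)}
  {x₀ : EuclideanSpace ℝ (Fin M)}

/-- Every iterate after the start is a convex combination of two projected points. -/
theorem norm_fastGradient_fst_le (hR : 0 ≤ R) (hx₀ : ‖x₀‖ ≤ R) (k : ℕ) :
    ‖(fastGradient R L g x₀ k).1‖ ≤ R := by
  cases k with
  | zero => simpa [fastGradient] using hx₀
  | succ k =>
    simp only [fastGradient]
    have hz := norm_ballProj_le hR (-(1 / L) • ((fastGradient R L g x₀ k).2 +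
      (((k : ℝ) + 1) / 2) • g (fastGradient R L g x₀ k).1))
    have hy := norm_ballProj_le hR (-(1 / L) • g (fastGradient R L g x₀ k).1
      + (fastGradient R L g x₀ k).1)
    refine (norm_add_le _ _).trans ?_
    rw [norm_smul, norm_smul, Real.norm_of_nonneg (by positivity),
      Real.norm_of_nonneg (by positivity)]
    calc _ ≤ 2 / ((k : ℝ) + 3) * R + ((k : ℝ) + 1) / ((k : ℝ) + 3) * R := by
          gcongr
          exact hy
      _ = R := by field_simp; ring

/-- The estimate sequence of the fast gradient method, with a base error `E` that accounts for a
starting point other than the centre of the ball. -/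
theorem fastGradient_estimate {f : EuclideanSpace ℝ (Fin M) → ℝ} (hR : 0 ≤ R) (hL : 0 < L)
    (hx₀ : ‖x₀‖ ≤ R)
    (hlow : ∀ x y, f x + inner ℝ (g x) (y - x) ≤ f y)
    (hup : ∀ x y, f y ≤ f x + inner ℝ (g x) (y - x) + L / 2 * ‖y - x‖ ^ 2)
    {E : ℝ} (hE : 1 / 2 * inner ℝ (g x₀) x₀ + ‖g x₀‖ ^ 2 / (8 * L) ≤ E) (n : ℕ)
    {u : EuclideanSpace ℝ (Fin M)} (hu : ‖u‖ ≤ R) :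
    ((n : ℝ) + 1) * (n + 2) / 4 * f (stepY R L g (fastGradient R L g x₀ n).1)
        + L / 2 * ‖u - ballProj R (-(1 / L) • (fastGradient R L g x₀ (n + 1)).2)‖ ^ 2
      ≤ L / 2 * ‖u‖ ^ 2 + ∑ k ∈ Finset.range (n + 1), ((k : ℝ) + 1) / 2 *
        (f (fastGradient R L g x₀ k).1 + inner ℝ (g (fastGradient R L g x₀ k).1)
          (u - (fastGradient R L g x₀ k).1)) + E := by
  set X : ℕ → EuclideanSpace ℝ (Fin M) := fun k => (fastGradient R L g x₀ k).1 with hX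
  set w : ℕ → EuclideanSpace ℝ (Fin M) := fun k => (fastGradient R L g x₀ k).2 with hw
  set y : ℕ → EuclideanSpace ℝ (Fin M) := fun k => stepY R L g (X k) with hy
  set z : ℕ → EuclideanSpace ℝ (Fin M) := fun k => ballProj R (-(1 / L) • w (k + 1)) with hz
  have hXR : ∀ k, ‖X k‖ ≤ R := norm_fastGradient_fst_le hR hx₀
  have hyR : ∀ k, ‖y k‖ ≤ R := fun k => norm_ballProj_le hR _
  have hzR : ∀ k, ‖z k‖ ≤ R := fun k => norm_ballProj_le hR _
  have hX0 : X 0 = x₀ := rfl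
  have hXs : ∀ k : ℕ, X (k + 1)
      = (2 / ((k : ℝ) + 3)) • z k + (((k : ℝ) + 1) / ((k : ℝ) + 3)) • y k := fun k => rfl
  have hws : ∀ k : ℕ, w (k + 1) = w k + (((k : ℝ) + 1) / 2) • g (X k) := fun k => rfl
  have hw0 : w 0 = 0 := rfl
  -- The weights `(i + 1) / 2`, `i ≤ k`, sum to `(k + 1) (k + 2) / 4`. The linear part of `ψ k` has
  -- slope `w (k + 1)`, so `z k` minimizes `ψ k` over the ball.
  set ψ : ℕ → EuclideanSpace ℝ (Fin M) → ℝ := fun k v => L / 2 * ‖v‖ ^ 2 +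
    ∑ i ∈ Finset.range (k + 1), ((i : ℝ) + 1) / 2 * (f (X i) + inner ℝ (g (X i)) (v - X i)) with hψ
  -- growth of the model around its minimizer
  have hsum : ∀ k : ℕ, ∀ v v' : EuclideanSpace ℝ (Fin M),
      ∑ i ∈ Finset.range k, ((i : ℝ) + 1) / 2 * (f (X i) + inner ℝ (g (X i)) (v - X i))
      - ∑ i ∈ Finset.range k, ((i : ℝ) + 1) / 2 * (f (X i) + inner ℝ (g (X i)) (v' - X i))
      = inner ℝ (w k) v - inner ℝ (w k) v' := by
    intro k v v'
    induction k with
    | zero => simp [hw0]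
    | succ k ih =>
      rw [Finset.sum_range_succ, Finset.sum_range_succ, hws, inner_add_left, inner_add_left,
        real_inner_smul_left, real_inner_smul_left, inner_sub_right, inner_sub_right]
      linear_combination ih
  have hgrow : ∀ k : ℕ, ∀ v : EuclideanSpace ℝ (Fin M), ‖v‖ ≤ R →
      ψ k (z k) + L / 2 * ‖v - z k‖ ^ 2 ≤ ψ k v := by
    intro k v hv
    have h1 := inner_add_sq_ballProj_le (c := 1 / L) hR hL 0 (w (k + 1)) hv rfl
    simp only [add_zero, sub_zero] at h1
    have h2 := hsum (k + 1) v (z k)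
    simp only [hψ]
    change inner ℝ (w (k + 1)) (z k) + L / 2 * ‖z k‖ ^ 2 + L / 2 * ‖v - z k‖ ^ 2 ≤ _ at h1
    linarith
  -- `y k` minimizes the quadratic upper model of `f` at `X k` over the ball, so any other point of
  -- the ball gives a weaker upper bound.
  have hprox : ∀ k : ℕ, ∀ v : EuclideanSpace ℝ (Fin M), ‖v‖ ≤ R →
      f (y k) ≤ f (X k) + inner ℝ (g (X k)) (v - X k) + L / 2 * ‖v - X k‖ ^ 2 := by
    intro k v hv
    have h1 := inner_add_sq_ballProj_le (c := 1 / L) hR hL (X k) (g (X k)) hv rfl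
    have h2 := hup (X k) (y k)
    change inner ℝ (g (X k)) (y k) + L / 2 * ‖y k - X k‖ ^ 2 + L / 2 * ‖v - y k‖ ^ 2 ≤ _ at h1
    rw [inner_sub_right] at h2 ⊢
    have : 0 ≤ L / 2 * ‖v - y k‖ ^ 2 := by positivity
    linarith
  have main : ∀ k : ℕ, ((k : ℝ) + 1) * (k + 2) / 4 * f (y k) ≤ ψ k (z k) + E := by
    intro k
    induction k with
    | zero =>
      have h1 := hprox 0 (X 0) (hXR 0)
      simp only [sub_self, inner_zero_right, norm_zero] at h1
      rw [hX0] at h1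
      -- Completing the square: `L/2 ‖z‖² + ⟨g, z⟩/2 + ‖g‖²/(8L) = ‖2Lz + g‖²/(8L)`. With the
      -- remaining `⟨g, x₀⟩ / 2` this determines the lower bound required of `E`.
      have h2' := norm_add_sq_real ((2 * L) • z 0) (g x₀)
      rw [norm_smul, real_inner_smul_left, Real.norm_of_nonneg (by positivity)] at h2'
      have h3 : 0 ≤ ‖(2 * L) • z 0 + g x₀‖ ^ 2 := by positivity
      rw [h2'] at h3
      have h4 : 0 ≤ L / 2 * ‖z 0‖ ^ 2 + 1 / 2 * inner ℝ (g x₀) (z 0) + ‖g x₀‖ ^ 2 / (8 * L) := by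
        have : L / 2 * ‖z 0‖ ^ 2 + 1 / 2 * inner ℝ (g x₀) (z 0) + ‖g x₀‖ ^ 2 / (8 * L)
            = ((2 * L * ‖z 0‖) ^ 2 + 2 * (2 * L * inner ℝ (z 0) (g x₀)) + ‖g x₀‖ ^ 2)
              / (8 * L) := by
          rw [real_inner_comm]; field_simp; ring
        rw [this]; positivity
      simp only [hψ, zero_add, Finset.sum_range_one, hX0, inner_sub_right]
      push_cast
      linarith
    | succ k ih =>
      set x' := X (k + 1) with hx'
      set G := g x' with hG
      have hk : (0 : ℝ) ≤ k := Nat.cast_nonneg k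
      -- the point between `y k` and `z (k + 1)`
      set τ : ℝ := 2 / ((k : ℝ) + 3) with hτ
      set v := x' + τ • (z (k + 1) - z k) with hv
      have hveq : v = τ • z (k + 1) + (((k : ℝ) + 1) / ((k : ℝ) + 3)) • y k := by
        rw [hv, hx', hXs, smul_sub]; abel
      have hvR : ‖v‖ ≤ R := by
        rw [hveq]
        refine (norm_add_le _ _).trans ?_
        rw [norm_smul, norm_smul, Real.norm_of_nonneg (by positivity),
          Real.norm_of_nonneg (by positivity)]
        calc _ ≤ τ * R + ((k : ℝ) + 1) / ((k : ℝ) + 3) * R := by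
              gcongr
              · exact hzR _
              · exact hyR _
          _ = R := by rw [hτ]; field_simp; ring
      have h1 := hprox (k + 1) v hvR
      have hvx : v - x' = τ • (z (k + 1) - z k) := by rw [hv]; abel
      rw [← hx', hvx, norm_smul, real_inner_smul_right, Real.norm_of_nonneg (by positivity),
        ← hG] at h1
      have h2 := hgrow k (z (k + 1)) (hzR _)
      have h3 := hlow x' (y k)
      rw [← hG] at h3
      have h4 : ψ (k + 1) (z (k + 1)) = ψ k (z (k + 1)) + ((k : ℝ) + 2) / 2 *
          (f x' + inner ℝ G (z (k + 1) - x')) := by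
        simp only [hψ]
        rw [Finset.sum_range_succ (n := k + 1)]
        push_cast
        ring
      -- the combination of `y k` and `z k` that gives the iterate
      have h5 : ((k : ℝ) + 1) * (k + 2) / 4 * inner ℝ G (y k - x')
          + ((k : ℝ) + 2) / 2 * inner ℝ G (z (k + 1) - x')
          = ((k : ℝ) + 2) / 2 * inner ℝ G (z (k + 1) - z k) := by
        have hGx : inner ℝ G x' = τ * inner ℝ G (z k)
            + ((k : ℝ) + 1) / ((k : ℝ) + 3) * inner ℝ G (y k) := by
          rw [hx', hXs, inner_add_right, real_inner_smul_right, real_inner_smul_right]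
        rw [inner_sub_right, inner_sub_right, inner_sub_right, hGx, hτ]
        field_simp
        ring
      rw [h4]
      have hA : (0 : ℝ) ≤ ((k : ℝ) + 2) * (k + 3) / 4 := by positivity
      have h6 := mul_le_mul_of_nonneg_left h1 hA
      have h7 := mul_le_mul_of_nonneg_left h3
        (show (0 : ℝ) ≤ ((k : ℝ) + 1) * (k + 2) / 4 by positivity)
      -- Total weight times `τ ^ 2` is `(k + 2) / (k + 3) ≤ 1`: this is why linearly growing weights
      -- are admissible. The quadratic error is then absorbed by the growth of `ψ k` around `z k` in
      -- `h2`.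
      have h8 : ((k : ℝ) + 2) * (k + 3) / 4 * (L / 2 * (τ * ‖z (k + 1) - z k‖) ^ 2)
          ≤ L / 2 * ‖z (k + 1) - z k‖ ^ 2 := by
        have : ((k : ℝ) + 2) * (k + 3) / 4 * (L / 2 * (τ * ‖z (k + 1) - z k‖) ^ 2)
            = (((k : ℝ) + 2) / (k + 3)) * (L / 2 * ‖z (k + 1) - z k‖ ^ 2) := by
          rw [hτ]; field_simp; ring
        rw [this]
        refine mul_le_of_le_one_left (by positivity) ?_
        rw [div_le_one (by positivity)]; linarith
      have h9 : ((k : ℝ) + 2) * (k + 3) / 4 * (τ * inner ℝ G (z (k + 1) - z k))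
          = ((k : ℝ) + 2) / 2 * inner ℝ G (z (k + 1) - z k) := by
        rw [hτ]; field_simp; ring
      push_cast
      rw [show (k : ℝ) + 1 + 1 = k + 2 by ring, show (k : ℝ) + 1 + 2 = k + 3 by ring]
      linarith
  have h1 := main n
  have h2 := hgrow n u hu
  change _ + L / 2 * ‖u - z n‖ ^ 2 ≤ ψ n u + E
  linarith

end FastGradient

/-! ### The truncated channel -/

section Truncation

variable {X A : Set ℝ} {W : ℕ → ℝ → ℝ}

/-- Normalization replaces the infinite tail, for which termwise Lipschitz bounds are useless, by a
finite combination of Lipschitz maps. -/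
theorem truncate_eq (hW : IsChannel X W) {x : ℝ} (hx : x ∈ X) (i : Fin M) :
    truncate W M i x = W i x + (1 / (M : ℝ)) * (1 - ∑ j : Fin M, W j x) := by
  have h := (hW.2 x hx).summable.sum_add_tsum_nat_add M
  rw [(hW.2 x hx).tsum_eq, Finset.sum_range] at h
  rw [truncate, ← h]
  ring

theorem truncate_nonneg (hW : IsChannel X W) {x : ℝ} (hx : x ∈ X) (i : Fin M) :
    0 ≤ truncate W M i x :=
  add_nonneg (hW.1 x hx i) (mul_nonneg (by positivity) (tsum_nonneg fun j => hW.1 x hx _))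

theorem sum_truncate (hM : 0 < M) (hW : IsChannel X W) {x : ℝ} (hx : x ∈ X) :
    ∑ i, truncate W M i x = 1 := by
  have : (M : ℝ) ≠ 0 := by positivity
  simp only [truncate_eq hW hx, Finset.sum_add_distrib, Finset.sum_const, Finset.card_univ,
    Fintype.card_fin, nsmul_eq_mul]
  field_simp
  ring

theorem minProb_truncate_le (hW : IsChannel X W) (hA : A ⊆ X) {x : ℝ} (hx : x ∈ A) (i : Fin M) :
    minProb (truncate W M) A ≤ truncate W M i x := by
  refine csInf_le ⟨0, ?_⟩ ⟨i, x, hx, rfl⟩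
  rintro _ ⟨j, y, hy, rfl⟩
  exact truncate_nonneg hW (hA hy) j

theorem pos_of_minProb_pos {V : Fin M → ℝ → ℝ} (h : 0 < minProb V A) : 0 < M := by
  rcases Nat.eq_zero_or_pos M with rfl | h0
  -- For `M = 0` the infimum runs over the empty set and takes the default value `0`.
  · simp [minProb] at h
  · exact h0

/-- The tail mass is returned uniformly, so an increment of the truncated channel is an increment of
`W` minus its mean over the `M` outputs. -/
theorem truncate_sub (hW : IsChannel X W) {x y : ℝ} (hx : x ∈ X) (hy : y ∈ X) (i : Fin M) :
    truncate W M i x - truncate W M i y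
      = (W i x - W i y) - (1 / (M : ℝ)) * ∑ j : Fin M, (W j x - W j y) := by
  rw [truncate_eq hW hx, truncate_eq hW hy, Finset.sum_sub_distrib]
  ring

/-- Centring does not increase the sum of squares. -/
theorem sum_sq_truncate_sub_le (hM : 0 < M) (hW : IsChannel X W) {L : ℝ≥0}
    (hL : ∀ i, LipschitzOnWith L (W i) X) {x y : ℝ} (hx : x ∈ X) (hy : y ∈ X) :
    ∑ i, (truncate W M i x - truncate W M i y) ^ 2 ≤ M * (L * |x - y|) ^ 2 := by
  have hM' : (M : ℝ) ≠ 0 := by positivity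
  set d : Fin M → ℝ := fun i => W i x - W i y with hd
  have hdi : ∀ i, |d i| ≤ L * |x - y| := fun i => (hL i).dist_le_mul x hx y hy
  have h1 : ∑ i, (truncate W M i x - truncate W M i y) ^ 2
      = ∑ i, d i ^ 2 - (1 / (M : ℝ)) * (∑ j, d j) ^ 2 := by
    have h0 : ∀ i : Fin M, (truncate W M i x - truncate W M i y) ^ 2
        = d i ^ 2 - 2 * (1 / (M : ℝ) * ∑ j, d j) * d i + (1 / (M : ℝ) * ∑ j, d j) ^ 2 := fun i => by
      rw [truncate_sub hW hx hy]
      ring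
    simp only [h0, Finset.sum_add_distrib, Finset.sum_sub_distrib, ← Finset.mul_sum,
      Finset.sum_const, Finset.card_univ, Fintype.card_fin, nsmul_eq_mul]
    field_simp
    ring
  rw [h1]
  have h2 : ∑ i, d i ^ 2 ≤ ∑ _i : Fin M, (L * |x - y|) ^ 2 :=
    Finset.sum_le_sum fun i _ => sq_le_sq' (abs_le.mp (hdi i)).1 (abs_le.mp (hdi i)).2
  rw [Finset.sum_const, Finset.card_univ, Fintype.card_fin, nsmul_eq_mul] at h2
  have h3 : 0 ≤ (1 / (M : ℝ)) * (∑ j, d j) ^ 2 := by positivity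
  linarith

theorem continuousOn_truncate (hW : IsChannel X W) {L : ℝ≥0}
    (hL : ∀ i, LipschitzOnWith L (W i) X) (i : Fin M) : ContinuousOn (truncate W M i) X := by
  refine ContinuousOn.congr (f := fun x => W i x + (1 / (M : ℝ)) * (1 - ∑ j : Fin M, W j x)) ?_
    fun x hx => truncate_eq hW hx i
  have := fun i => (hL i).continuousOn
  fun_prop

end Truncation

/-! ### The Lipschitz constant of the payoff -/

/-- `t log t`, up to a linear term, is Lipschitz on `[γ, 1]` with constant `log (1 / γ) / 2`. -/
theorem abs_mul_logb_sub_le {γ u v : ℝ} (hγ : 0 < γ) (hu : u ∈ Set.Icc γ 1)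
    (hv : v ∈ Set.Icc γ 1) :
    |(u * Real.logb 2 u - v * Real.logb 2 v)
      - (1 / Real.log 2 - Real.logb 2 γ⁻¹ / 2) * (u - v)| ≤ Real.logb 2 γ⁻¹ / 2 * |u - v| := by
  have hl2 : 0 < Real.log 2 := Real.log_pos one_lt_two
  -- The slope `c` centres the derivative: `log t` ranges over `[-log (1 / γ), 0]`, an interval of
  -- half-length `log (1 / γ) / 2`.
  set c := 1 / Real.log 2 - Real.logb 2 γ⁻¹ / 2 with hc
  have hder : ∀ t ∈ Set.Icc γ 1, HasDerivWithinAt (fun t => t * Real.logb 2 t - c * t)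
      (Real.logb 2 t + Real.logb 2 γ⁻¹ / 2) (Set.Icc γ 1) t := by
    intro t ht
    have ht0 : t ≠ 0 := (hγ.trans_le ht.1).ne'
    have h1 : HasDerivAt (fun t => t * Real.logb 2 t)
        (1 * Real.logb 2 t + t * (t⁻¹ / Real.log 2)) t :=
      (hasDerivAt_id t).mul ((Real.hasDerivAt_log ht0).div_const (Real.log 2))
    have h2 := (h1.sub ((hasDerivAt_id t).const_mul c)).hasDerivWithinAt (s := Set.Icc γ 1)
    refine h2.congr_deriv ?_
    rw [hc]
    field_simp
    ring
  have hbd : ∀ t ∈ Set.Icc γ 1, ‖Real.logb 2 t + Real.logb 2 γ⁻¹ / 2‖ ≤ Real.logb 2 γ⁻¹ / 2 := by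
    intro t ht
    have h1 : Real.logb 2 γ ≤ Real.logb 2 t := Real.logb_le_logb_of_le one_lt_two hγ ht.1
    have h2 : Real.logb 2 t ≤ 0 := Real.logb_nonpos one_lt_two (hγ.le.trans ht.1) ht.2
    rw [Real.logb_inv, Real.norm_eq_abs, abs_le]
    constructor <;> linarith
  have := (convex_Icc γ 1).norm_image_sub_le_of_norm_hasDerivWithin_le hder hbd hv hu
  rw [Real.norm_eq_abs, Real.norm_eq_abs] at this
  convert this using 2
  ring

theorem abs_inner_le_of_sq_sum_le {l e : Fin M → ℝ} {a b : ℝ} (ha : 0 ≤ a) (hb : 0 ≤ b)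
    (hl : ∑ i, l i ^ 2 ≤ a ^ 2) (he : ∑ i, e i ^ 2 ≤ b ^ 2) : |∑ i, l i * e i| ≤ a * b := by
  refine abs_le_of_sq_le_sq ?_ (by positivity)
  rw [mul_pow]
  refine (Finset.sum_mul_sq_le_sq_mul_sq _ _ _).trans ?_
  have : 0 ≤ ∑ i, e i ^ 2 := Finset.sum_nonneg fun _ _ => sq_nonneg _
  gcongr

section MinProb

variable {A : Set ℝ} {V : Fin M → ℝ → ℝ}

theorem mul_minProb_le_one (hV : ∀ i, ∀ x ∈ A, minProb V A ≤ V i x)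
    (hsum : ∀ x ∈ A, ∑ i, V i x = 1) (hA : A.Nonempty) : M * minProb V A ≤ 1 := by
  obtain ⟨x, hx⟩ := hA
  have : ∑ _i : Fin M, minProb V A ≤ ∑ i, V i x := Finset.sum_le_sum fun i _ => hV i x hx
  rwa [hsum x hx, Finset.sum_const, Finset.card_univ, Fintype.card_fin, nsmul_eq_mul] at this

/-- A channel with a single output has smallest transition probability `1`. -/
theorem minProb_eq_one {V : Fin 1 → ℝ → ℝ} (hsum : ∀ x ∈ A, ∑ i, V i x = 1)
    (hA : A.Nonempty) : minProb V A = 1 := by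
  have : {t | ∃ i : Fin 1, ∃ x ∈ A, t = V i x} = {1} := by
    ext t
    simp only [Set.mem_ofPred_eq, Set.mem_singleton_iff]
    constructor
    · rintro ⟨i, x, hx, rfl⟩
      have := hsum x hx
      rw [Fin.sum_univ_one] at this
      rw [Subsingleton.elim i 0, this]
    · rintro rfl
      obtain ⟨x, hx⟩ := hA
      have := hsum x hx
      rw [Fin.sum_univ_one] at this
      exact ⟨0, x, hx, this.symm⟩
  rw [minProb, this, csInf_singleton]

/-- Either there is a single output, or every transition probability bound is at most `1 / 2`. -/
theorem logb_inv_minProb_cases (hγ : 0 < minProb V A) (hV : ∀ i, ∀ x ∈ A, minProb V A ≤ V i x)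
    (hsum : ∀ x ∈ A, ∑ i, V i x = 1) (hA : A.Nonempty) :
    (M = 1 ∧ Real.logb 2 (minProb V A)⁻¹ = 0) ∨
      (2 ≤ (M : ℝ) ∧ 1 ≤ Real.logb 2 (minProb V A)⁻¹) := by
  have hM := pos_of_minProb_pos hγ
  rcases Nat.lt_or_ge 1 M with h | h
  · right
    have h2 : (2 : ℝ) ≤ M := by exact_mod_cast h
    refine ⟨h2, ?_⟩
    rw [Real.le_logb_iff_rpow_le one_lt_two (by positivity), Real.rpow_one,
      le_inv_comm₀ two_pos hγ]
    have := mul_minProb_le_one hV hsum hA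
    nlinarith
  · left
    obtain rfl : M = 1 := by omega
    simp [minProb_eq_one hsum hA]

theorem one_le_one_div_log_two : 1 ≤ 1 / Real.log 2 := by
  rw [le_div_iff₀ (Real.log_pos one_lt_two)]
  linarith [Real.log_two_lt_d9]

theorem one_div_log_two_le : 1 / Real.log 2 ≤ 2 := by
  rw [div_le_iff₀ (Real.log_pos one_lt_two)]
  linarith [Real.log_two_gt_d9]

end MinProb

/-- For multipliers in the dual feasible set, the payoff is Lipschitz with constant `L_f`. -/
theorem abs_payoff_sub_le {X A : Set ℝ} {W : ℕ → ℝ → ℝ} (hW : IsChannel X W) {L : ℝ≥0}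
    (hL : ∀ i, LipschitzOnWith L (W i) X) (hA : A ⊆ X)
    (hγ : 0 < minProb (truncate W M) A) {l : EuclideanSpace ℝ (Fin M)}
    (hl : l ∈ dualSet (truncate W M) A) {x y : ℝ} (hx : x ∈ A) (hy : y ∈ A) :
    |payoff (truncate W M) l x - payoff (truncate W M) l y|
      ≤ constLf (truncate W M) A L * |x - y| := by
  have hM := pos_of_minProb_pos hγ
  have hV : ∀ i, ∀ x ∈ A, minProb (truncate W M) A ≤ truncate W M i x := fun i x hx =>
    minProb_truncate_le hW hA hx i
  have hsum : ∀ x ∈ A, ∑ i, truncate W M i x = 1 := fun x hx => sum_truncate hM hW (hA hx)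
  have hle1 : ∀ i, ∀ x ∈ A, truncate W M i x ≤ 1 := fun i x hx => by
    rw [← hsum x hx]
    exact Finset.single_le_sum (f := fun i => truncate W M i x)
      (fun j _ => truncate_nonneg hW (hA hx) j) (Finset.mem_univ i)
  have hcases := logb_inv_minProb_cases hγ hV hsum ⟨x, hx⟩
  have hLf : constLf (truncate W M) A L = L * (M : ℝ) ^ 2
      * max (Real.logb 2 (minProb (truncate W M) A)⁻¹) (1 / Real.log 2)
      + M * L * |Real.logb 2 (minProb (truncate W M) A)⁻¹ - 1 / Real.log 2| := rfl
  have hl' : ‖l‖ ≤ M * max (Real.logb 2 (minProb (truncate W M) A)⁻¹) (1 / Real.log 2) := hl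
  set V := truncate W M with hVdef
  set γ := minProb V A
  set ℓ := Real.logb 2 γ⁻¹ with hℓ
  set m := max ℓ (1 / Real.log 2) with hm
  set δ := L * |x - y| with hδ
  have hm1 : 1 ≤ m := one_le_one_div_log_two.trans (le_max_right _ _)
  have hδ0 : 0 ≤ δ := by positivity
  have hℓ0 : 0 ≤ ℓ := by rcases hcases with h | h <;> linarith [h.2]
  set e : Fin M → ℝ := fun i => V i x - V i y with he
  have he2 : ∑ i, e i ^ 2 ≤ (√M * δ) ^ 2 := by
    rw [mul_pow, Real.sq_sqrt (by positivity)]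
    exact sum_sq_truncate_sub_le hM hW hL (hA hx) (hA hy)
  have hesum : ∑ i, e i = 0 := by
    rw [he, Finset.sum_sub_distrib, hsum x hx, hsum y hy, sub_self]
  have h1 : |∑ i, l i * e i| ≤ M * m * (√M * δ) := by
    refine abs_inner_le_of_sq_sum_le (by positivity) (by positivity) ?_ he2
    rw [← EuclideanSpace.real_norm_sq_eq]
    gcongr
  have h2 : ∑ i, |e i| ≤ √M * (√M * δ) := by
    have := abs_inner_le_of_sq_sum_le (l := fun _ : Fin M => 1) (e := fun i => |e i|) (a := √M)
      (b := √M * δ) (by positivity) (by positivity)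
      (by rw [Real.sq_sqrt (by positivity)]; simp) (by simpa using he2)
    simp only [one_mul] at this
    exact (le_abs_self _).trans this
  -- The increments `e i` sum to zero, so the linear correction of `abs_mul_logb_sub_le` costs
  -- nothing.
  have h3 : |(∑ i, V i x * Real.logb 2 (V i x)) - ∑ i, V i y * Real.logb 2 (V i y)|
      ≤ ℓ / 2 * ∑ i, |e i| := by
    have : (∑ i, V i x * Real.logb 2 (V i x)) - ∑ i, V i y * Real.logb 2 (V i y)
        = ∑ i, ((V i x * Real.logb 2 (V i x) - V i y * Real.logb 2 (V i y))
          - (1 / Real.log 2 - ℓ / 2) * e i) := by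
      rw [Finset.sum_sub_distrib, ← Finset.mul_sum, hesum, Finset.sum_sub_distrib]
      ring
    rw [this, Finset.mul_sum]
    refine (Finset.abs_sum_le_sum_abs _ _).trans (Finset.sum_le_sum fun i _ => ?_)
    exact abs_mul_logb_sub_le hγ ⟨hV i x hx, hle1 i x hx⟩ ⟨hV i y hy, hle1 i y hy⟩
  have h4 : payoff V l x - payoff V l y = ∑ i, l i * e i
      + ((∑ i, V i x * Real.logb 2 (V i x)) - ∑ i, V i y * Real.logb 2 (V i y)) := by
    have h0 : ∑ i, l i * e i = ∑ i, V i x * l i - ∑ i, V i y * l i := by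
      rw [← Finset.sum_sub_distrib]
      exact Finset.sum_congr rfl fun i _ => by rw [he]; ring
    rw [h0]
    simp only [payoff, entropy, Finset.sum_neg_distrib]
    ring
  have hMM : √(M : ℝ) * (√M * δ) = M * δ := by
    rw [← mul_assoc, Real.mul_self_sqrt (by positivity)]
  have h5 : |payoff V l x - payoff V l y| ≤ M * m * (√M * δ) + ℓ / 2 * (M * δ) := by
    rw [h4]
    refine (abs_add_le _ _).trans (add_le_add h1 (h3.trans ?_))
    rw [← hMM]
    gcongr
  refine h5.trans ?_
  -- Centring saved a factor `√M`, and that saving pays for the entropy: `√M ≤ M - 1/2` once `M ≥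
  -- 2`, while `ℓ = 0` for `M = 1`. The second summand of `L_f` is then mere slack.
  have h6 : √(M : ℝ) * m + ℓ / 2 ≤ M * m := by
    rcases hcases with ⟨hM1, h0⟩ | ⟨hM2, h1'⟩
    · rw [h0, hM1]; simp
    · have hs : √(M : ℝ) ≤ M - 1 / 2 := by
        rw [Real.sqrt_le_left (by linarith)]
        nlinarith
      have : ℓ ≤ m := le_max_left _ _
      nlinarith
  have h7 : (√(M : ℝ) * m + ℓ / 2) * (M * δ) ≤ M * m * (M * δ) := by gcongr
  have h8 : 0 ≤ M * |ℓ - 1 / Real.log 2| * δ := by positivity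
  rw [hLf]
  calc _ = (√(M : ℝ) * m + ℓ / 2) * (M * δ) := by ring
    _ ≤ M * m * (M * δ) + M * |ℓ - 1 / Real.log 2| * δ := by linarith
    _ = _ := by rw [hδ]; ring

/-! ### Exponential tilting -/

section Tilting

variable {a b : ℝ} {h σ : ℝ → ℝ}

/-- If exponential tilting by `t ≥ 0` does not make the mean of `σ` positive, then `t` is small. -/
theorem tilt_mul_le (hab : a < b) (hh : ContinuousOn h (Set.Icc a b))
    (hσ : ContinuousOn σ (Set.Icc a b)) {φ K t : ℝ}
    (hφ : ∀ x ∈ Set.Icc a b, ∀ y ∈ Set.Icc a b, h x - h y ≤ φ)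
    (hK : ∀ x ∈ Set.Icc a b, ∀ y ∈ Set.Icc a b, |σ x - σ y| ≤ K * |x - y|)
    {x₀ x₁ : ℝ} (hx₀ : x₀ ∈ Set.Icc a b) (hx₁ : x₁ ∈ Set.Icc a b) (h₀ : σ x₀ < 0) (h₁ : 0 < σ x₁)
    (ht : 0 ≤ t) (hint : ∫ x in Set.Icc a b, Real.exp (h x + t * σ x) * σ x ≤ 0) :
    t * (σ x₁ / 2) ≤ φ + Real.log (2 * K * (b - a) / σ x₁) := by
  set d := σ x₁ with hd
  have hφ0 : 0 ≤ φ := by simpa using hφ x₁ hx₁ x₁ hx₁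
  have hdiff : d ≤ K * |x₁ - x₀| := by
    have := hK x₁ hx₁ x₀ hx₀
    have := le_abs_self (σ x₁ - σ x₀)
    linarith
  have hKpos : 0 < K := by
    by_contra hneg
    have := mul_nonpos_of_nonpos_of_nonneg (not_lt.mp hneg) (abs_nonneg (x₁ - x₀))
    linarith
  have hdist : |x₁ - x₀| ≤ b - a := by
    rw [abs_le]; constructor <;> linarith [hx₀.1, hx₀.2, hx₁.1, hx₁.2]
  have hdK : d ≤ K * (b - a) := hdiff.trans (by gcongr)
  have hratio : 2 ≤ 2 * K * (b - a) / d := by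
    rw [le_div_iff₀ h₁]; linarith
  have hlog2 : Real.log 2 ≤ Real.log (2 * K * (b - a) / d) :=
    Real.log_le_log two_pos hratio
  -- For small `t` the bound is already contained in `φ ≥ 0` and `hlog2`. Otherwise `t d > 2 log 2 >
  -- 1`, which is used in `hpoint`.
  rcases le_or_gt (t * (d / 2)) (Real.log 2) with hsmall | hbig
  · linarith
  -- an interval of length `d / (2 K)` on which `σ ≥ d / 2`
  set η := d / (2 * K) with hη
  have hη0 : 0 < η := by positivity
  have hηle : 2 * η ≤ b - a := by
    rw [hη]
    field_simp
    linarith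
  -- Since `2 η ≤ b - a`, an interval of length `η` fits on at least one side of `x₁`.
  obtain ⟨c, hcJ⟩ : ∃ c, Set.Icc c (c + η) ⊆ Set.Icc a b ∩ {x | |x - x₁| ≤ η} := by
    rcases le_or_gt (x₁ + η) b with hc | hc
    · refine ⟨x₁, fun x hx => ⟨⟨hx₁.1.trans hx.1, hx.2.trans hc⟩, ?_⟩⟩
      change |x - x₁| ≤ η
      exact abs_le.mpr ⟨by linarith [hx.1], by linarith [hx.2]⟩
    · refine ⟨x₁ - η, fun x hx => ⟨⟨by linarith [hx.1], by linarith [hx.2, hx₁.2]⟩, ?_⟩⟩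
      change |x - x₁| ≤ η
      exact abs_le.mpr ⟨by linarith [hx.1], by linarith [hx.2]⟩
  have hJσ : ∀ x ∈ Set.Icc c (c + η), d / 2 ≤ σ x := by
    intro x hx
    have h1 := hK x (hcJ hx).1 x₁ hx₁
    have h2 : K * |x - x₁| ≤ K * η := mul_le_mul_of_nonneg_left (hcJ hx).2 hKpos.le
    have h3 : K * η = d / 2 := by rw [hη]; field_simp
    have := neg_abs_le (σ x - σ x₁)
    linarith
  obtain ⟨xm, hxm, hmin⟩ := isCompact_Icc.exists_isMinOn (Set.nonempty_Icc.mpr hab.le) hh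
  set C₁ := Real.exp (h xm + t * (d / 2)) * (d / 2) with hC₁
  set C₂ := Real.exp (h xm + φ) * (d / 2) with hC₂
  have hC₁0 : 0 ≤ C₁ := by positivity
  have hC₂0 : 0 ≤ C₂ := by positivity
  -- Where `σ < 0`, put `z = -t σ`. From `t d ≥ 1` and `2 z ≤ exp z` one gets `-σ ≤ (d / 2) exp z`,
  -- so the negative part of the integrand never exceeds `C₂`. On the short interval the integrand
  -- is at least `C₁`. A nonpositive integral then forces `η C₁ ≤ (b - a) C₂`.
  have hpoint : ∀ x ∈ Set.Icc a b, (Set.Icc c (c + η)).indicator (fun _ => C₁) x - C₂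
      ≤ Real.exp (h x + t * σ x) * σ x := by
    intro x hx
    have hmx : h xm ≤ h x := hmin hx
    by_cases hxJ : x ∈ Set.Icc c (c + η)
    · rw [Set.indicator_of_mem hxJ]
      have h1 := hJσ x hxJ
      have : C₁ ≤ Real.exp (h x + t * σ x) * σ x := by
        rw [hC₁]
        gcongr
      linarith
    · rw [Set.indicator_of_notMem hxJ]
      rcases le_or_gt 0 (σ x) with hs | hs
      · have : 0 ≤ Real.exp (h x + t * σ x) * σ x := by positivity
        linarith
      · have hz : 0 ≤ t * -σ x := mul_nonneg ht (by linarith)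
        have hq := Real.quadratic_le_exp_of_nonneg hz
        have h2z : 2 * (t * -σ x) ≤ Real.exp (t * -σ x) := by
          nlinarith [sq_nonneg (t * -σ x - 1)]
        have hl2 := Real.log_two_gt_d9
        have h3 : -σ x ≤ d / 2 * Real.exp (t * -σ x) := by
          have : 1 * -σ x ≤ t * d * -σ x :=
            mul_le_mul_of_nonneg_right (by linarith) (by linarith)
          calc -σ x ≤ d / 2 * (2 * (t * -σ x)) := by linarith
            _ ≤ _ := by gcongr
        have h4 : Real.exp (t * σ x) * -σ x ≤ d / 2 := by
          have := mul_le_mul_of_nonneg_left h3 (Real.exp_pos (t * σ x)).le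
          refine this.trans (le_of_eq ?_)
          rw [mul_left_comm, ← Real.exp_add, show t * σ x + t * -σ x = 0 by ring, Real.exp_zero,
            mul_one]
        have h5 : Real.exp (h x) ≤ Real.exp (h xm + φ) :=
          Real.exp_le_exp.mpr (by linarith [hφ x hx xm hxm])
        have h6 : Real.exp (h x) * (Real.exp (t * σ x) * -σ x) ≤ C₂ :=
          mul_le_mul h5 h4 (mul_nonneg (Real.exp_pos _).le (by linarith)) (Real.exp_pos _).le
        rw [Real.exp_add]
        linarith
  have hi : IntegrableOn (fun x => Real.exp (h x + t * σ x) * σ x) (Set.Icc a b) :=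
    ContinuousOn.integrableOn_Icc (by fun_prop)
  have hJi : IntegrableOn ((Set.Icc c (c + η)).indicator fun _ => C₁) (Set.Icc a b) :=
    IntegrableOn.indicator (integrableOn_const (by simp)) measurableSet_Icc
  have hc2i : IntegrableOn (fun _ : ℝ => C₂) (Set.Icc a b) := integrableOn_const (by simp)
  have hI := setIntegral_mono_on (hJi.sub hc2i) hi measurableSet_Icc hpoint
  have hsub : Set.Icc c (c + η) ⊆ Set.Icc a b := fun x hx => (hcJ hx).1
  have hval : ∫ x in Set.Icc a b, ((Set.Icc c (c + η)).indicator (fun _ => C₁) x - C₂)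
      = η * C₁ - (b - a) * C₂ := by
    rw [integral_sub hJi hc2i, setIntegral_indicator measurableSet_Icc,
      Set.inter_eq_right.mpr hsub, setIntegral_const, setIntegral_const, Real.volume_real_Icc_of_le
      (by linarith), Real.volume_real_Icc_of_le hab.le, smul_eq_mul, smul_eq_mul]
    ring
  have hfin : η * C₁ ≤ (b - a) * C₂ := by
    have : η * C₁ - (b - a) * C₂ ≤ 0 := by rw [← hval]; exact hI.trans hint
    linarith
  have hexp : Real.exp (t * (d / 2)) ≤ Real.exp φ * (2 * K * (b - a) / d) := by
    rw [hC₁, hC₂, Real.exp_add, Real.exp_add] at hfin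
    have h1 : Real.exp (h xm) * (d / 2) * (η * Real.exp (t * (d / 2)))
        ≤ Real.exp (h xm) * (d / 2) * ((b - a) * Real.exp φ) := by linarith
    have h2 := le_of_mul_le_mul_left h1 (by positivity)
    have h3 : Real.exp φ * (2 * K * (b - a) / d) = (b - a) * Real.exp φ / η := by
      rw [hη]; field_simp
    rw [h3, le_div_iff₀ hη0]
    linarith
  have hpos : 0 < 2 * K * (b - a) / d := by linarith
  have := Real.log_le_log (Real.exp_pos _) hexp
  rwa [Real.log_exp, Real.log_mul (Real.exp_pos _).ne' hpos.ne', Real.log_exp] at this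

theorem continuous_integral_tilt (hh : ContinuousOn h (Set.Icc a b))
    (hσ : ContinuousOn σ (Set.Icc a b)) :
    Continuous fun t : ℝ => ∫ x in Set.Icc a b, Real.exp (h x + t * σ x) * σ x := by
  obtain ⟨Ch, hCh⟩ := isCompact_Icc.exists_bound_of_continuousOn hh
  obtain ⟨Cs, hCs⟩ := isCompact_Icc.exists_bound_of_continuousOn hσ
  refine continuous_iff_continuousAt.mpr fun t₀ => ?_
  refine continuousAt_of_dominated (bound := fun _ => Real.exp (Ch + (|t₀| + 1) * Cs) * Cs)
    (Filter.Eventually.of_forall fun t => ?_) ?_ (integrableOn_const (by simp))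
    (Filter.Eventually.of_forall fun x => by fun_prop)
  · exact ContinuousOn.aestronglyMeasurable (by fun_prop) measurableSet_Icc
  · filter_upwards [Metric.ball_mem_nhds t₀ one_pos] with t ht
    refine (ae_restrict_iff' measurableSet_Icc).mpr (Filter.Eventually.of_forall fun x hx => ?_)
    rw [norm_mul, Real.norm_of_nonneg (Real.exp_pos _).le]
    have h1 := (Real.norm_eq_abs _ ▸ hCh x hx : |h x| ≤ Ch)
    have h2 := (Real.norm_eq_abs _ ▸ hCs x hx : |σ x| ≤ Cs)
    have h3 : |t| ≤ |t₀| + 1 := by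
      have h4 : |t - t₀| < 1 := ht
      have := abs_sub_abs_le_abs_sub t t₀
      linarith
    have h5 : t * σ x ≤ (|t₀| + 1) * Cs := by
      refine (le_abs_self _).trans ?_
      rw [abs_mul]
      gcongr
    have h6 := (le_abs_self _).trans h1
    have h7 : 0 ≤ Cs := (abs_nonneg _).trans h2
    rw [Real.norm_eq_abs]
    gcongr

/-- Some exponential tilt makes the mean of `σ` vanish. -/
theorem exists_tilt (hab : a < b) (hh : ContinuousOn h (Set.Icc a b)) {K : ℝ}
    (hσ : ContinuousOn σ (Set.Icc a b))
    (hK : ∀ x ∈ Set.Icc a b, ∀ y ∈ Set.Icc a b, |σ x - σ y| ≤ K * |x - y|)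
    {x₀ x₁ : ℝ} (hx₀ : x₀ ∈ Set.Icc a b) (hx₁ : x₁ ∈ Set.Icc a b) (h₀ : σ x₀ < 0)
    (h₁ : 0 < σ x₁) :
    ∃ t : ℝ, ∫ x in Set.Icc a b, Real.exp (h x + t * σ x) * σ x = 0 := by
  obtain ⟨C, hC⟩ := isCompact_Icc.exists_bound_of_continuousOn hh
  have hφ : ∀ x ∈ Set.Icc a b, ∀ y ∈ Set.Icc a b, h x - h y ≤ 2 * C := fun x hx y hy => by
    have h1 := abs_le.mp (Real.norm_eq_abs _ ▸ hC x hx : |h x| ≤ C)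
    have h2 := abs_le.mp (Real.norm_eq_abs _ ▸ hC y hy : |h y| ≤ C)
    linarith [h1.2, h2.1]
  have hlarge : ∀ B d : ℝ, 0 < d → ∃ t : ℝ, 0 ≤ t ∧ B < t * (d / 2) := fun B d hd =>
    ⟨2 / d * (|B| + 1), by positivity, by
      have : 2 / d * (|B| + 1) * (d / 2) = |B| + 1 := by field_simp
      linarith [le_abs_self B]⟩
  -- Tilts beyond the bound of `tilt_mul_le`, for `σ` and for `-σ`, give integrals of opposite
  -- signs; the intermediate value theorem does the rest.
  obtain ⟨t₁, ht₁, hlt₁⟩ := hlarge (2 * C + Real.log (2 * K * (b - a) / σ x₁)) (σ x₁) h₁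
  obtain ⟨t₀, ht₀, hlt₀⟩ := hlarge (2 * C + Real.log (2 * K * (b - a) / -σ x₀)) (-σ x₀) (by linarith)
  have hpos : 0 ≤ ∫ x in Set.Icc a b, Real.exp (h x + t₁ * σ x) * σ x := by
    by_contra hneg
    exact absurd (tilt_mul_le hab hh hσ hφ hK hx₀ hx₁ h₀ h₁ ht₁ (not_le.mp hneg).le)
      (not_le.mpr hlt₁)
  have hneg : ∫ x in Set.Icc a b, Real.exp (h x + -t₀ * σ x) * σ x ≤ 0 := by
    by_contra hpos'
    refine absurd (tilt_mul_le (σ := fun x => -σ x) (K := K) hab hh hσ.neg hφ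
      (fun x hx y hy => ?_) hx₁ hx₀ (by linarith) (by linarith) ht₀ ?_) (not_le.mpr hlt₀)
    · rw [show -σ x - -σ y = -(σ x - σ y) by ring, abs_neg]
      exact hK x hx y hy
    · simp only [mul_neg, integral_neg, neg_mul] at hpos' ⊢
      linarith
  exact intermediate_value_univ (-t₀) t₁ (continuous_integral_tilt hh hσ) ⟨hneg, hpos⟩

end Tilting

/-! ### Maximum and mean of an exponential -/

/-- `∫₀ʳ exp (-K y) dy ≥ r / (1 + K r)`. -/
theorem div_le_integral_exp_neg {K r : ℝ} (hK : 0 ≤ K) (hr : 0 ≤ r) :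
    r / (1 + K * r) ≤ ∫ y in (0 : ℝ)..r, Real.exp (-(K * y)) := by
  rcases hK.eq_or_lt with rfl | hKpos
  · simp
  have hder : ∀ y ∈ Set.uIcc 0 r, HasDerivAt (fun y => -Real.exp (-(K * y)) / K)
      (Real.exp (-(K * y))) y := fun y _ => by
    have h1 : HasDerivAt (fun y => -(K * y)) (-(K * 1)) y := ((hasDerivAt_id y).const_mul K).neg
    refine (h1.exp.neg.div_const K).congr_deriv ?_
    field_simp
  rw [intervalIntegral.integral_eq_sub_of_hasDerivAt hder (Continuous.intervalIntegrable
    (by fun_prop) _ _)]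
  have h1 : Real.exp (-(K * r)) ≤ 1 / (1 + K * r) := by
    rw [Real.exp_neg, ← one_div]
    exact one_div_le_one_div_of_le (by positivity) (by linarith [Real.add_one_le_exp (K * r)])
  have h2 : -Real.exp (-(K * r)) / K - -Real.exp (-(K * 0)) / K
      = (1 - Real.exp (-(K * r))) / K := by
    simp only [mul_zero, neg_zero, Real.exp_zero]; ring
  rw [h2, le_div_iff₀ hKpos]
  have h3 : r / (1 + K * r) * K = 1 - 1 / (1 + K * r) := by
    have : 1 + K * r ≠ 0 := by positivity
    field_simp
    ring
  linarith

/-- A Lipschitz exponent cannot concentrate: the maximum of `exp w` is controlled by its mean. -/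
theorem mul_exp_le_integral_exp {a b K : ℝ} {w : ℝ → ℝ} (hab : a < b) (hK0 : 0 ≤ K)
    (hw : ContinuousOn w (Set.Icc a b))
    (hK : ∀ x ∈ Set.Icc a b, ∀ y ∈ Set.Icc a b, |w x - w y| ≤ K * |x - y|)
    {c : ℝ} (hc : c ∈ Set.Icc a b) :
    (b - a) * Real.exp (w c) ≤ (1 + K * (b - a)) * ∫ x in Set.Icc a b, Real.exp (w x) := by
  have hlow : ∀ x ∈ Set.Icc a b, Real.exp (w c) * Real.exp (-(K * |x - c|)) ≤ Real.exp (w x) := by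
    intro x hx
    rw [← Real.exp_add]
    refine Real.exp_le_exp.mpr ?_
    have := neg_abs_le (w x - w c)
    linarith [hK x hx c hc]
  have hI : ∫ x in Set.Icc a b, Real.exp (w c) * Real.exp (-(K * |x - c|))
      ≤ ∫ x in Set.Icc a b, Real.exp (w x) :=
    setIntegral_mono_on (ContinuousOn.integrableOn_Icc (by fun_prop))
      (ContinuousOn.integrableOn_Icc (by fun_prop)) measurableSet_Icc hlow
  have hsplit : ∫ x in Set.Icc a b, Real.exp (-(K * |x - c|))
      = (∫ y in (0 : ℝ)..(c - a), Real.exp (-(K * y))) + ∫ y in (0 : ℝ)..(b - c),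
        Real.exp (-(K * y)) := by
    rw [integral_Icc_eq_integral_Ioc, ← intervalIntegral.integral_of_le hab.le,
      ← intervalIntegral.integral_add_adjacent_intervals (b := c)
        (Continuous.intervalIntegrable (by fun_prop) _ _)
        (Continuous.intervalIntegrable (by fun_prop) _ _)]
    congr 1
    · rw [← sub_self c, ← intervalIntegral.integral_comp_sub_left (fun y => Real.exp (-(K * y))) c]
      refine intervalIntegral.integral_congr fun x hx => ?_
      rw [Set.uIcc_of_le hc.1] at hx
      rw [abs_of_nonpos (by linarith [hx.2]), neg_sub]
    · rw [← sub_self c, ← intervalIntegral.integral_comp_sub_right (fun y => Real.exp (-(K * y))) c]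
      refine intervalIntegral.integral_congr fun x hx => ?_
      rw [Set.uIcc_of_le hc.2] at hx
      rw [abs_of_nonneg (by linarith [hx.1])]
  rw [integral_const_mul, hsplit] at hI
  -- Used for the two parts into which `c` divides the interval; their lengths add up to `b - a`.
  have hpart : ∀ r, 0 ≤ r → r ≤ b - a →
      r ≤ (1 + K * (b - a)) * ∫ y in (0 : ℝ)..r, Real.exp (-(K * y)) := fun r hr hrle => by
    have h1 := div_le_integral_exp_neg hK0 hr
    have hpos : 0 < 1 + K * r := by positivity
    rw [div_le_iff₀' hpos] at h1
    refine h1.trans ?_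
    have : 0 ≤ ∫ y in (0 : ℝ)..r, Real.exp (-(K * y)) :=
      intervalIntegral.integral_nonneg hr fun y _ => (Real.exp_pos _).le
    gcongr
  have h1 := hpart (c - a) (by linarith [hc.1]) (by linarith [hc.2])
  have h2 := hpart (b - c) (by linarith [hc.2]) (by linarith [hc.1])
  have hpos : 0 ≤ 1 + K * (b - a) := by nlinarith
  calc (b - a) * Real.exp (w c) ≤ ((1 + K * (b - a)) * ((∫ y in (0 : ℝ)..(c - a),
        Real.exp (-(K * y))) + ∫ y in (0 : ℝ)..(b - c), Real.exp (-(K * y)))) * Real.exp (w c) := by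
        gcongr
        linarith
    _ = (1 + K * (b - a)) * (Real.exp (w c) * ((∫ y in (0 : ℝ)..(c - a),
        Real.exp (-(K * y))) + ∫ y in (0 : ℝ)..(b - c), Real.exp (-(K * y)))) := by ring
    _ ≤ _ := by gcongr

/-! ### Existence of the Gibbs densities -/

section Gibbs

variable {a b S ν : ℝ} {V : Fin M → ℝ → ℝ} {s : ℝ → ℝ} {l : EuclideanSpace ℝ (Fin M)}

theorem continuousOn_entropy {A : Set ℝ} (hVc : ∀ i, ContinuousOn (V i) A)
    (hVpos : ∀ i, ∀ x ∈ A, 0 < V i x) : ContinuousOn (fun x => entropy fun i => V i x) A := by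
  unfold entropy Real.logb
  have := fun i => (hVc i).log fun x hx => (hVpos i x hx).ne'
  fun_prop

theorem continuousOn_payoff {A : Set ℝ} (hVc : ∀ i, ContinuousOn (V i) A)
    (hVpos : ∀ i, ∀ x ∈ A, 0 < V i x) : ContinuousOn (payoff V l) A := by
  have := continuousOn_entropy hVc hVpos
  unfold payoff
  fun_prop

/-- With the cost recentred at `S`, the normalization separates as a constant factor and the
constraint says that a tilted integral of `s - S` vanishes. -/
theorem gibbs_eq (μ : ℝ × ℝ) (x : ℝ) : gibbs V s ν l μ x
    = Real.exp (Real.log 2 * (μ.1 + μ.2 * S)) *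
      Real.exp (Real.log 2 * (1 / ν * payoff V l x) + Real.log 2 * μ.2 * (s x - S)) := by
  rw [gibbs, Real.rpow_def_of_pos two_pos, ← Real.exp_add]
  ring_nf

/-- The parameters of the analytical optimizer exist. -/
theorem exists_isFeasible_gibbs (hab : a < b) (hf : ContinuousOn (payoff V l) (Set.Icc a b))
    {K : ℝ≥0} (hs : LipschitzOnWith K s (Set.Icc a b))
    (hS₁ : sInf (s '' Set.Icc a b) < S) (hS₂ : S < sSup (s '' Set.Icc a b)) :
    ∃ μ : ℝ × ℝ, IsFeasible (Set.Icc a b) s S (gibbs V s ν l μ) := by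
  have hne : (s '' Set.Icc a b).Nonempty := (Set.nonempty_Icc.mpr hab.le).image _
  obtain ⟨_, ⟨x₀, hx₀, rfl⟩, hlt₀⟩ := exists_lt_of_csInf_lt hne hS₁
  obtain ⟨_, ⟨x₁, hx₁, rfl⟩, hlt₁⟩ := exists_lt_of_lt_csSup hne hS₂
  have hsc := hs.continuousOn
  have hl2 : Real.log 2 ≠ 0 := (Real.log_pos one_lt_two).ne'
  obtain ⟨t, ht⟩ := exists_tilt (h := fun x => Real.log 2 * (1 / ν * payoff V l x))
    (σ := fun x => s x - S) (K := K) hab (by fun_prop) (by fun_prop)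
    (fun x hx y hy => by simpa [Real.dist_eq] using hs.dist_le_mul x hx y hy) hx₀ hx₁ (by linarith) (by linarith)
  set E : ℝ → ℝ := fun x => Real.exp (Real.log 2 * (1 / ν * payoff V l x) + t * (s x - S)) with hE
  have hEc : ContinuousOn E (Set.Icc a b) := by fun_prop
  have hEi : IntegrableOn E (Set.Icc a b) := hEc.integrableOn_Icc
  set Z := ∫ x in Set.Icc a b, E x with hZ
  have hZpos : 0 < Z := by
    rw [hZ, setIntegral_pos_iff_support_of_nonneg_ae
      (Filter.Eventually.of_forall fun x => (Real.exp_pos _).le) hEi]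
    have : Function.support E = Set.univ := Set.eq_univ_of_forall fun x => (Real.exp_pos _).ne'
    rw [this, Set.univ_inter, Real.volume_Icc]
    simpa using hab
  -- The solution of `ln 2 * μ₂ = t` and `ln 2 * (μ₁ + μ₂ S) = -ln Z`.
  set μ : ℝ × ℝ := (-(Real.log Z) / Real.log 2 - t / Real.log 2 * S, t / Real.log 2) with hμ
  have hg : ∀ x, gibbs V s ν l μ x = Z⁻¹ * E x := fun x => by
    rw [gibbs_eq (S := S)]
    have h1 : Real.log 2 * (μ.1 + μ.2 * S) = -Real.log Z := by
      simp only [hμ]; field_simp; ring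
    have h2 : Real.log 2 * μ.2 = t := by simp only [hμ]; field_simp
    rw [h1, h2, Real.exp_neg, Real.exp_log hZpos]
  refine ⟨μ, ⟨?_, Filter.Eventually.of_forall fun x => ?_, ?_⟩, ?_⟩
  · rw [show gibbs V s ν l μ = fun x => Z⁻¹ * E x from funext hg]
    exact hEi.const_mul _
  · rw [hg]
    have := Real.exp_pos (Real.log 2 * (1 / ν * payoff V l x) + t * (s x - S))
    positivity
  · simp only [hg]
    rw [integral_const_mul, ← hZ, inv_mul_cancel₀ hZpos.ne']
  · have h1 : ∀ x, gibbs V s ν l μ x * s x = Z⁻¹ * (E x * (s x - S)) + S * (Z⁻¹ * E x) :=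
      fun x => by rw [hg]; ring
    simp only [h1]
    have hi : IntegrableOn (fun x => E x * (s x - S)) (Set.Icc a b) :=
      ContinuousOn.integrableOn_Icc (by fun_prop)
    rw [integral_add (hi.const_mul _) ((hEi.const_mul _).const_mul _), integral_const_mul,
      integral_const_mul, integral_const_mul, ht, ← hZ, inv_mul_cancel₀ hZpos.ne']
    ring

end Gibbs

/-! ### Smoothness of the dual function `F` -/

/-- A supremum of affine functions whose maximizers are stable up to a quadratic error lies
between each supporting affine function and a quadratic perturbation of it. -/
theorem sSup_quadratic_bounds {E ι : Type*} [NormedAddCommGroup E] [InnerProductSpace ℝ E]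
    {P : ι → Prop} {val : E → ι → ℝ} {opt : E → ι} {grad : E → E} {C : ℝ}
    (hP : ∀ x, P (opt x))
    (hub : ∀ x y q, P q → val y q ≤ val y (opt x) + C * ‖y - x‖ ^ 2)
    (haff : ∀ x y, val y (opt x) = val x (opt x) + inner ℝ (grad x) (y - x)) (x y : E) :
    sSup {t | ∃ q, P q ∧ t = val x q} = val x (opt x) ∧
    sSup {t | ∃ q, P q ∧ t = val x q} + inner ℝ (grad x) (y - x)
      ≤ sSup {t | ∃ q, P q ∧ t = val y q} ∧
    sSup {t | ∃ q, P q ∧ t = val y q} ≤ sSup {t | ∃ q, P q ∧ t = val x q}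
      + inner ℝ (grad x) (y - x) + C * ‖y - x‖ ^ 2 := by
  -- The case `y = x` of `hub` is the optimality of `opt x`.
  have heq : ∀ x, sSup {t | ∃ q, P q ∧ t = val x q} = val x (opt x) := fun x => by
    refine IsGreatest.csSup_eq ⟨⟨opt x, hP x, rfl⟩, ?_⟩
    rintro _ ⟨q, hq, rfl⟩
    simpa using hub x x q hq
  refine ⟨heq x, ?_, ?_⟩
  · rw [heq x, heq y, ← haff]
    simpa using hub y y (opt x) (hP x)
  · rw [heq x, heq y, ← haff]
    exact hub x y _ (hP y)

section FiniteEntropy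

theorem stdSimplex_le_one {q : Fin M → ℝ} (hq : q ∈ stdSimplex ℝ (Fin M)) (i : Fin M) :
    q i ≤ 1 := by
  rw [← hq.2]
  exact Finset.single_le_sum (fun j _ => hq.1 j) (Finset.mem_univ i)

theorem norm_toLp_le_one {q : Fin M → ℝ} (hq : q ∈ stdSimplex ℝ (Fin M)) :
    ‖(WithLp.toLp 2 q : EuclideanSpace ℝ (Fin M))‖ ≤ 1 := by
  refine abs_le_of_sq_le_sq' ?_ zero_le_one |>.2
  rw [EuclideanSpace.real_norm_sq_eq, one_pow, ← hq.2]
  refine Finset.sum_le_sum fun i _ => ?_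
  change q i ^ 2 ≤ q i
  nlinarith [hq.1 i, stdSimplex_le_one hq i]

theorem abs_coord_le_norm (l : EuclideanSpace ℝ (Fin M)) (i : Fin M) : |l i| ≤ ‖l‖ := by
  simpa using PiLp.norm_apply_le l i

/-- The finite case of `integral_mul_le_add_relEntropy`. -/
theorem sum_mul_le_add_relEntropy {q₀ q h : Fin M → ℝ} (hq₀ : q₀ ∈ stdSimplex ℝ (Fin M))
    (hpos : ∀ i, 0 < q₀ i) (hq : q ∈ stdSimplex ℝ (Fin M)) {B : ℝ} (hB0 : 0 ≤ B)
    (hB : ∀ i, |h i| ≤ B) :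
    ∑ i, q i * h i ≤ ∑ i, q₀ i * h i
      + (∑ i, q i * Real.log (q i) - ∑ i, q i * Real.log (q₀ i)) + B ^ 2 / 2 := by
  have := integral_mul_le_add_relEntropy (m := (Measure.count : Measure (Fin M))) (p₀ := q₀)
    (p := q) (h := h) Integrable.of_finite (Filter.Eventually.of_forall hpos)
    (by rw [integral_count]; exact hq₀.2) Integrable.of_finite (Filter.Eventually.of_forall hq.1)
    (by rw [integral_count]; exact hq.2) Integrable.of_finite Integrable.of_finite
    (measurable_of_finite h).aestronglyMeasurable hB0 (Filter.Eventually.of_forall hB)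
  simpa only [integral_count] using this

theorem entropy_eq (q : Fin M → ℝ) :
    entropy q = -(∑ i, q i * Real.log (q i)) / Real.log 2 := by
  rw [entropy, Finset.sum_neg_distrib, neg_div, Finset.sum_div]
  simp only [Real.logb, mul_div_assoc]

/-- The maximizer of `H(q) - ⟨l, q⟩` over the simplex. -/
noncomputable def softmin (l : EuclideanSpace ℝ (Fin M)) (i : Fin M) : ℝ :=
  Real.exp (-(Real.log 2 * l i)) / ∑ j, Real.exp (-(Real.log 2 * l j))

variable (hM : 0 < M)
include hM

theorem sum_exp_pos (l : EuclideanSpace ℝ (Fin M)) :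
    0 < ∑ j, Real.exp (-(Real.log 2 * l j)) :=
  Finset.sum_pos (fun _ _ => Real.exp_pos _) ⟨⟨0, hM⟩, Finset.mem_univ _⟩

theorem softmin_pos (l : EuclideanSpace ℝ (Fin M)) (i : Fin M) : 0 < softmin l i :=
  div_pos (Real.exp_pos _) (sum_exp_pos hM l)

theorem softmin_mem (l : EuclideanSpace ℝ (Fin M)) : softmin l ∈ stdSimplex ℝ (Fin M) := by
  refine ⟨fun i => (softmin_pos hM l i).le, ?_⟩
  simp only [softmin]
  rw [← Finset.sum_div, div_self (sum_exp_pos hM l).ne']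

theorem log_softmin (l : EuclideanSpace ℝ (Fin M)) (i : Fin M) :
    Real.log (softmin l i)
      = -(Real.log 2 * l i) - Real.log (∑ j, Real.exp (-(Real.log 2 * l j))) := by
  rw [softmin, Real.log_div (Real.exp_pos _).ne' (sum_exp_pos hM l).ne', Real.log_exp]

/-- The logarithm of `softmin x` is affine in `x`, so the relative entropy to it measures the loss
in the objective at `x`. The perturbation `-ln 2 (y - x)` is bounded by `ln 2 ‖y - x‖`; after
division by `ln 2`, Hoeffding's term is `(ln 2 / 2) ‖y - x‖²`, and `ln 2 ≤ 1`. -/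
theorem entropy_sub_le (x y : EuclideanSpace ℝ (Fin M)) {q : Fin M → ℝ}
    (hq : q ∈ stdSimplex ℝ (Fin M)) :
    entropy q - ∑ i, y i * q i
      ≤ (entropy (softmin x) - ∑ i, y i * softmin x i) + 1 / 2 * ‖y - x‖ ^ 2 := by
  have hl2 : 0 < Real.log 2 := Real.log_pos one_lt_two
  have hl1 : Real.log 2 ≤ 1 := by linarith [Real.log_two_lt_d9]
  set Z := ∑ j, Real.exp (-(Real.log 2 * x j)) with hZ
  have hlog : ∀ r : Fin M → ℝ, r ∈ stdSimplex ℝ (Fin M) → ∑ i, r i * Real.log (softmin x i)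
      = -(Real.log 2 * ∑ i, x i * r i) - Real.log Z := by
    intro r hr
    have : ∀ i, r i * Real.log (softmin x i)
        = -(Real.log 2 * (x i * r i)) - r i * Real.log Z := fun i => by
      rw [log_softmin hM]; ring
    simp only [this]
    rw [Finset.sum_sub_distrib, ← Finset.sum_mul, hr.2, one_mul, Finset.sum_neg_distrib,
      ← Finset.mul_sum]
  have key := sum_mul_le_add_relEntropy (h := fun i => -(Real.log 2 * (y i - x i)))
    (softmin_mem hM x) (softmin_pos hM x) hq (B := Real.log 2 * ‖y - x‖) (by positivity)
    (fun i => by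
      rw [abs_neg, abs_mul, abs_of_pos hl2]
      exact mul_le_mul_of_nonneg_left (abs_coord_le_norm (y - x) i) hl2.le)
  have hlin : ∀ r : Fin M → ℝ, ∑ i, r i * -(Real.log 2 * (y i - x i))
      = -(Real.log 2 * ((∑ i, y i * r i) - ∑ i, x i * r i)) := fun r => by
    rw [← Finset.sum_sub_distrib, Finset.mul_sum, ← Finset.sum_neg_distrib]
    exact Finset.sum_congr rfl fun i _ => by ring
  rw [hlin, hlin, hlog q hq] at key
  have h1 : entropy (softmin x) = (Real.log 2 * (∑ i, x i * softmin x i) + Real.log Z)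
      / Real.log 2 := by
    rw [entropy_eq, hlog _ (softmin_mem hM x)]
    ring
  have h2 : Real.log 2 * entropy q = -∑ i, q i * Real.log (q i) := by
    rw [entropy_eq]; field_simp
  have h3 : Real.log 2 * entropy (softmin x)
      = Real.log 2 * (∑ i, x i * softmin x i) + Real.log Z := by
    rw [h1]; field_simp
  have h4 : (Real.log 2 * ‖y - x‖) ^ 2 / 2 ≤ Real.log 2 * (1 / 2 * ‖y - x‖ ^ 2) := by
    have : (Real.log 2 * ‖y - x‖) ^ 2 / 2 = Real.log 2 * (Real.log 2 * (1 / 2 * ‖y - x‖ ^ 2)) := by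
      ring
    rw [this]
    refine mul_le_mul_of_nonneg_left (mul_le_of_le_one_left (by positivity) hl1) hl2.le
  refine le_of_mul_le_mul_left ?_ hl2
  linarith

theorem dualF_bounds (x y : EuclideanSpace ℝ (Fin M)) :
    dualF x = entropy (softmin x) - ∑ i, x i * softmin x i ∧
    dualF x + inner ℝ (-WithLp.toLp 2 (softmin x)) (y - x) ≤ dualF y ∧
    dualF y ≤ dualF x + inner ℝ (-WithLp.toLp 2 (softmin x)) (y - x)
      + 1 / 2 * ‖y - x‖ ^ 2 := by
  refine sSup_quadratic_bounds (P := fun q => q ∈ stdSimplex ℝ (Fin M))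
    (val := fun (l : EuclideanSpace ℝ (Fin M)) q => entropy q - ∑ i, l i * q i) (opt := softmin)
    (grad := fun x => -WithLp.toLp 2 (softmin x)) (softmin_mem hM)
    (fun x y q hq => entropy_sub_le hM x y hq) (fun x y => ?_) x y
  rw [inner_neg_left, inner_sub_right]
  simp only [PiLp.inner_apply, RCLike.inner_apply, conj_trivial]
  ring

theorem gradient_dualF (x : EuclideanSpace ℝ (Fin M)) :
    ∇ dualF x = -WithLp.toLp 2 (softmin x) :=
  (hasGradientAt_of_quadratic_bound (fun y => (dualF_bounds hM x y).2.1)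
    fun y => (dualF_bounds hM x y).2.2).gradient

theorem le_dualF (l : EuclideanSpace ℝ (Fin M)) {q : Fin M → ℝ} (hq : q ∈ stdSimplex ℝ (Fin M)) :
    entropy q - ∑ i, l i * q i ≤ dualF l := by
  rw [(dualF_bounds hM l l).1]
  simpa using entropy_sub_le hM l l hq

end FiniteEntropy

/-! ### Weak duality and smoothness of `G_ν` -/

section Smoothing

variable {a b S ν : ℝ} {V : Fin M → ℝ → ℝ} {s p : ℝ → ℝ}

theorem IsDensity.integrableOn_mul (hp : IsDensity (Set.Icc a b) p) {k : ℝ → ℝ}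
    (hk : ContinuousOn k (Set.Icc a b)) : IntegrableOn (fun x => p x * k x) (Set.Icc a b) :=
  hp.1.mul_continuousOn hk isCompact_Icc

theorem IsDensity.integral_mul_le (hp : IsDensity (Set.Icc a b) p) {k : ℝ → ℝ}
    (hk : ContinuousOn k (Set.Icc a b)) {C : ℝ} (hC : ∀ x ∈ Set.Icc a b, k x ≤ C) :
    ∫ x in Set.Icc a b, p x * k x ≤ C := by
  have h1 : ∫ x in Set.Icc a b, p x * k x ≤ ∫ x in Set.Icc a b, p x * C := by
    refine integral_mono_ae (hp.integrableOn_mul hk) (hp.1.mul_const C) ?_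
    filter_upwards [hp.2.1, ae_restrict_mem measurableSet_Icc] with x hx hxA
    exact mul_le_mul_of_nonneg_left (hC x hxA) hx
  rwa [integral_mul_const, hp.2.2, one_mul] at h1

theorem payoff_eq_add (l l' : EuclideanSpace ℝ (Fin M)) (x : ℝ) :
    payoff V l x = payoff V l' x + ∑ i, V i x * (l i - l' i) := by
  simp only [payoff, mul_sub, Finset.sum_sub_distrib]
  ring

variable (hVc : ∀ i, ContinuousOn (V i) (Set.Icc a b))
  (hVpos : ∀ i, ∀ x ∈ Set.Icc a b, 0 < V i x) (hsum : ∀ x ∈ Set.Icc a b, ∑ i, V i x = 1)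
include hVc

theorem integral_mul_sum_eq (hp : IsDensity (Set.Icc a b) p) (c : Fin M → ℝ) :
    ∫ x in Set.Icc a b, p x * ∑ i, V i x * c i = ∑ i, c i * outputDist V (Set.Icc a b) p i := by
  have h1 : ∀ x, p x * ∑ i, V i x * c i = ∑ i, c i * (V i x * p x) := fun x => by
    rw [Finset.mul_sum]
    exact Finset.sum_congr rfl fun i _ => by ring
  simp only [h1]
  rw [integral_finsetSum]
  · exact Finset.sum_congr rfl fun i _ => integral_const_mul _ _
  · intro i _
    have : IntegrableOn (fun x => V i x * p x) (Set.Icc a b) := by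
      simpa only [mul_comm] using hp.integrableOn_mul (hVc i)
    exact this.const_mul _

include hVpos

/-- The channel entropy in the payoff does not involve the multiplier, so the mean payoff is affine
in it with slope the output distribution. This is the source of the gradient of `G_ν`. -/
theorem integral_payoff_eq_add (hp : IsDensity (Set.Icc a b) p)
    (l l' : EuclideanSpace ℝ (Fin M)) :
    ∫ x in Set.Icc a b, p x * payoff V l x = (∫ x in Set.Icc a b, p x * payoff V l' x)
      + ∑ i, (l i - l' i) * outputDist V (Set.Icc a b) p i := by
  rw [← integral_mul_sum_eq hVc hp, ← integral_add (hp.integrableOn_mul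
    (continuousOn_payoff hVc hVpos)) (hp.integrableOn_mul (by fun_prop))]
  simp only [payoff_eq_add (V := V) l l', mul_add]

include hsum

theorem outputDist_mem (hp : IsDensity (Set.Icc a b) p) :
    outputDist V (Set.Icc a b) p ∈ stdSimplex ℝ (Fin M) := by
  constructor
  · intro i
    refine integral_nonneg_of_ae ?_
    filter_upwards [hp.2.1, ae_restrict_mem measurableSet_Icc] with x hx hxA
    exact mul_nonneg (hVpos i x hxA).le hx
  · have := integral_mul_sum_eq hVc hp fun _ => 1
    simp only [mul_one, one_mul] at this
    rw [← this, ← hp.2.2]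
    exact setIntegral_congr_fun measurableSet_Icc fun x hx => by simp only [hsum x hx, mul_one]

omit hVpos hsum in
theorem le_outputDist (hp : IsDensity (Set.Icc a b) p) {γ : ℝ}
    (hγ : ∀ i, ∀ x ∈ Set.Icc a b, γ ≤ V i x) (i : Fin M) :
    γ ≤ outputDist V (Set.Icc a b) p i := by
  have h1 : ∫ x in Set.Icc a b, γ * p x ≤ ∫ x in Set.Icc a b, V i x * p x := by
    have hi : IntegrableOn (fun x => V i x * p x) (Set.Icc a b) := by
      simpa only [mul_comm] using hp.integrableOn_mul (hVc i)
    refine integral_mono_ae (hp.1.const_mul γ) hi ?_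
    filter_upwards [hp.2.1, ae_restrict_mem measurableSet_Icc] with x hx hxA
    exact mul_le_mul_of_nonneg_right (hγ i x hxA) hx
  rwa [integral_const_mul, hp.2.2, mul_one] at h1

omit hVc hsum in
/-- The mutual information is the mean payoff for the multiplier `-log` of the output. -/
theorem mutualInfo_eq (hout : ∀ i, 0 < outputDist V (Set.Icc a b) p i) :
    mutualInfo V (Set.Icc a b) p = ∫ x in Set.Icc a b, p x *
      payoff V (WithLp.toLp 2 fun i => -Real.logb 2 (outputDist V (Set.Icc a b) p i)) x := by
  refine setIntegral_congr_fun measurableSet_Icc fun x hx => ?_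
  rw [mul_comm, relEntropy, payoff, entropy, ← Finset.sum_sub_distrib]
  congr 1
  refine Finset.sum_congr rfl fun i _ => ?_
  rw [Real.logb_div (hVpos i x hx).ne' (hout i).ne']
  ring

omit hVc hVpos hsum in
theorem entropy_eq_sum (q : Fin M → ℝ) : entropy q = ∑ i, -Real.logb 2 (q i) * q i := by
  rw [entropy]
  exact Finset.sum_congr rfl fun i _ => by ring

omit hsum in
theorem le_dualG {l : EuclideanSpace ℝ (Fin M)} (hp : IsFeasible (Set.Icc a b) s S p) :
    ∫ x in Set.Icc a b, p x * payoff V l x ≤ dualG V (Set.Icc a b) s S l := by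
  have hc : ContinuousOn (payoff V l) (Set.Icc a b) := continuousOn_payoff hVc hVpos
  obtain ⟨C, hC⟩ := isCompact_Icc.exists_bound_of_continuousOn hc
  refine le_csSup ⟨C, ?_⟩ ⟨p, hp, rfl⟩
  rintro _ ⟨p', hp', rfl⟩
  exact hp'.1.integral_mul_le hc fun x hx => (le_abs_self _).trans (hC x hx)

/-- Weak duality. -/
theorem mutualInfo_le (hM : 0 < M) {γ : ℝ} (hγ0 : 0 < γ)
    (hγ : ∀ i, ∀ x ∈ Set.Icc a b, γ ≤ V i x) (hp : IsFeasible (Set.Icc a b) s S p)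
    (l : EuclideanSpace ℝ (Fin M)) :
    mutualInfo V (Set.Icc a b) p ≤ dualF l + dualG V (Set.Icc a b) s S l := by
  -- Testing `F` with the output of `p` itself makes the terms `⟨l, q⟩` cancel.
  have h1 := le_dualF hM l (outputDist_mem hVc hVpos hsum hp.1)
  have h2 := le_dualG hVc hVpos (l := l) hp
  rw [mutualInfo_eq hVpos fun i => hγ0.trans_le (le_outputDist hVc hp.1 hγ i)]
  rw [integral_payoff_eq_add hVc hVpos hp.1 l
    (WithLp.toLp 2 fun i => -Real.logb 2 (outputDist V (Set.Icc a b) p i))] at h2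
  rw [entropy_eq_sum] at h1
  simp only [sub_mul, Finset.sum_sub_distrib] at h2
  linarith

omit hsum hVc hVpos in
theorem IsDensity.integrableOn_mul_log
    (hpl : IntegrableOn (fun x => p x * Real.logb 2 (p x)) (Set.Icc a b)) :
    IntegrableOn (fun x => p x * Real.log (p x)) (Set.Icc a b) := by
  refine (hpl.const_mul (Real.log 2)).congr (Filter.Eventually.of_forall fun x => ?_)
  have : Real.log 2 ≠ 0 := (Real.log_pos one_lt_two).ne'
  simp only [Real.logb]
  field_simp

omit hsum hVc hVpos in
theorem integral_mul_log_eq : ∫ x in Set.Icc a b, p x * Real.log (p x)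
    = -(Real.log 2 * diffEntropy (Set.Icc a b) p) := by
  have : Real.log 2 ≠ 0 := (Real.log_pos one_lt_two).ne'
  rw [diffEntropy, mul_neg, neg_neg, ← integral_const_mul]
  congr 1
  funext x
  rw [Real.logb]
  field_simp

omit hsum hVc hVpos in
/-- The uniform density maximizes the differential entropy. -/
theorem diffEntropy_le (hab : a < b) (hp : IsDensity (Set.Icc a b) p)
    (hpl : IntegrableOn (fun x => p x * Real.logb 2 (p x)) (Set.Icc a b)) :
    diffEntropy (Set.Icc a b) p ≤ Real.logb 2 (volume.real (Set.Icc a b)) := by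
  have hρ : 0 < b - a := by linarith
  have hl2 : 0 < Real.log 2 := Real.log_pos one_lt_two
  rw [Real.volume_real_Icc_of_le hab.le]
  -- With `h = 0` and `B = 0` the inequality is nonnegativity of the relative entropy, here to the
  -- uniform density.
  have key := integral_mul_le_add_relEntropy (m := volume.restrict (Set.Icc a b))
    (p₀ := fun _ => (b - a)⁻¹) (p := p) (h := fun _ => 0) (B := 0)
    (integrableOn_const (by simp)) (Filter.Eventually.of_forall fun _ => inv_pos.mpr hρ)
    (by rw [setIntegral_const, Real.volume_real_Icc_of_le hab.le, smul_eq_mul,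
      mul_inv_cancel₀ hρ.ne'])
    hp.1 hp.2.1 hp.2.2 (IsDensity.integrableOn_mul_log hpl) (hp.1.mul_const _)
    aestronglyMeasurable_const le_rfl (by simp)
  simp only [integral_mul_const, hp.2.2, integral_mul_log_eq, Real.log_inv, mul_zero,
    integral_zero] at key
  rw [Real.logb, le_div_iff₀ hl2]
  linarith

omit hsum hVc hVpos in
theorem optDensity_spec {A : Set ℝ} {l : EuclideanSpace ℝ (Fin M)}
    (hex : ∃ μ : ℝ × ℝ, IsFeasible A s S (gibbs V s ν l μ)) :
    ∃ μ : ℝ × ℝ, optDensity V A s S ν l = gibbs V s ν l μ ∧ IsFeasible A s S (gibbs V s ν l μ) := by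
  refine ⟨hex.choose, ?_, hex.choose_spec⟩
  rw [optDensity, dif_pos hex]

omit hsum hVc hVpos in
theorem logb_gibbs (l : EuclideanSpace ℝ (Fin M)) (μ : ℝ × ℝ) (x : ℝ) :
    Real.logb 2 (gibbs V s ν l μ x) = μ.1 + 1 / ν * payoff V l x + μ.2 * s x :=
  Real.logb_rpow two_pos (by norm_num)

omit hsum in
theorem integrableOn_gibbs_mul_logb (hsc : ContinuousOn s (Set.Icc a b))
    {l : EuclideanSpace ℝ (Fin M)} {μ : ℝ × ℝ}
    (hμ : IsDensity (Set.Icc a b) (gibbs V s ν l μ)) :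
    IntegrableOn (fun x => gibbs V s ν l μ x * Real.logb 2 (gibbs V s ν l μ x))
      (Set.Icc a b) := by
  simp only [logb_gibbs]
  have : ContinuousOn (payoff V l) (Set.Icc a b) := continuousOn_payoff hVc hVpos
  exact hμ.integrableOn_mul (by fun_prop)

omit hsum in
/-- The mean of the logarithm of the Gibbs density under a feasible density. -/
theorem integral_mul_logb_gibbs (hsc : ContinuousOn s (Set.Icc a b))
    {l : EuclideanSpace ℝ (Fin M)} (μ : ℝ × ℝ) (hp : IsFeasible (Set.Icc a b) s S p) :
    ∫ x in Set.Icc a b, p x * Real.logb 2 (gibbs V s ν l μ x)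
      = μ.1 + 1 / ν * (∫ x in Set.Icc a b, p x * payoff V l x) + μ.2 * S := by
  have hc : ContinuousOn (payoff V l) (Set.Icc a b) := continuousOn_payoff hVc hVpos
  have h1 : ∀ x, p x * Real.logb 2 (gibbs V s ν l μ x)
      = p x * μ.1 + 1 / ν * (p x * payoff V l x) + μ.2 * (p x * s x) := fun x => by
    rw [logb_gibbs]; ring
  have i1 : IntegrableOn (fun x => p x * μ.1) (Set.Icc a b) := hp.1.1.mul_const _
  have i2 : IntegrableOn (fun x => 1 / ν * (p x * payoff V l x)) (Set.Icc a b) :=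
    (hp.1.integrableOn_mul hc).const_mul _
  have i3 : IntegrableOn (fun x => μ.2 * (p x * s x)) (Set.Icc a b) :=
    (hp.1.integrableOn_mul hsc).const_mul _
  have i12 : IntegrableOn (fun x => p x * μ.1 + 1 / ν * (p x * payoff V l x)) (Set.Icc a b) :=
    i1.add i2
  simp only [h1]
  rw [integral_add i12 i3, integral_add i1 i2, integral_mul_const, integral_const_mul,
    integral_const_mul, hp.1.2.2, hp.2, one_mul]

/-- The smoothed objective at a feasible density, compared with the Gibbs density of another
multiplier. -/
theorem smoothed_le (hν : 0 < ν) (hsc : ContinuousOn s (Set.Icc a b))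
    (x y : EuclideanSpace ℝ (Fin M)) {μ : ℝ × ℝ}
    (hμ : IsFeasible (Set.Icc a b) s S (gibbs V s ν x μ)) (hp : IsFeasible (Set.Icc a b) s S p)
    (hpl : IntegrableOn (fun x => p x * Real.logb 2 (p x)) (Set.Icc a b)) :
    (∫ u in Set.Icc a b, p u * payoff V y u) + ν * diffEntropy (Set.Icc a b) p
      ≤ ((∫ u in Set.Icc a b, gibbs V s ν x μ u * payoff V y u)
        + ν * diffEntropy (Set.Icc a b) (gibbs V s ν x μ)) + 1 / (2 * ν) * ‖y - x‖ ^ 2 := by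
  have hl2 : 0 < Real.log 2 := Real.log_pos one_lt_two
  have hl1 : Real.log 2 ≤ 1 := by linarith [Real.log_two_lt_d9]
  set p₀ := gibbs V s ν x μ with hp₀
  have hpos : ∀ u, 0 < p₀ u := fun u => Real.rpow_pos_of_pos two_pos _
  have hlogeq : ∀ u, p u * Real.log (p₀ u) = Real.log 2 * (p u * Real.logb 2 (p₀ u)) := fun u => by
    rw [Real.logb]; field_simp
  have hci : IntegrableOn (fun u => p u * Real.logb 2 (p₀ u)) (Set.Icc a b) := by
    have : ContinuousOn (payoff V x) (Set.Icc a b) := continuousOn_payoff hVc hVpos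
    simp only [hp₀, logb_gibbs]
    exact hp.1.integrableOn_mul (by fun_prop)
  -- `D` is the change of payoff between the multipliers. It is an average of the coordinates of `y
  -- - x`, hence bounded by `‖y - x‖`.
  set D : ℝ → ℝ := fun u => ∑ i, V i u * (y i - x i) with hD
  have hDc : ContinuousOn D (Set.Icc a b) := by fun_prop
  have hDle : ∀ u ∈ Set.Icc a b, |D u| ≤ ‖y - x‖ := fun u hu => by
    calc |D u| ≤ ∑ i, |V i u * (y i - x i)| := Finset.abs_sum_le_sum_abs _ _
      _ ≤ ∑ i, V i u * ‖y - x‖ := Finset.sum_le_sum fun i _ => by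
          rw [abs_mul, abs_of_pos (hVpos i u hu)]
          exact mul_le_mul_of_nonneg_left (abs_coord_le_norm (y - x) i) (hVpos i u hu).le
      _ = ‖y - x‖ := by rw [← Finset.sum_mul, hsum u hu, one_mul]
  have key := integral_mul_le_add_relEntropy (m := volume.restrict (Set.Icc a b))
    (p₀ := p₀) (p := p) (h := fun u => Real.log 2 / ν * D u) (B := Real.log 2 / ν * ‖y - x‖)
    hμ.1.1 (Filter.Eventually.of_forall hpos) hμ.1.2.2 hp.1.1 hp.1.2.1 hp.1.2.2
    (IsDensity.integrableOn_mul_log hpl)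
    (by simp only [hlogeq]; exact hci.const_mul _)
    (ContinuousOn.aestronglyMeasurable (by fun_prop) measurableSet_Icc) (by positivity)
    (by
      filter_upwards [ae_restrict_mem measurableSet_Icc] with u hu
      rw [abs_mul, abs_of_pos (by positivity)]
      exact mul_le_mul_of_nonneg_left (hDle u hu) (by positivity))
  have hDint : ∀ r : ℝ → ℝ, IsDensity (Set.Icc a b) r →
      ∫ u in Set.Icc a b, r u * (Real.log 2 / ν * D u)
        = Real.log 2 / ν * ((∫ u in Set.Icc a b, r u * payoff V y u)
          - ∫ u in Set.Icc a b, r u * payoff V x u) := by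
    intro r hr
    rw [integral_payoff_eq_add hVc hVpos hr y x, ← integral_mul_sum_eq hVc hr, add_sub_cancel_left,
      ← integral_const_mul]
    congr 1
    funext u
    simp only [hD]
    ring
  simp only [hlogeq] at key
  rw [hDint p hp.1, hDint p₀ hμ.1, integral_mul_log_eq, integral_const_mul,
    integral_mul_logb_gibbs hVc hVpos hsc μ hp] at key
  have hent : diffEntropy (Set.Icc a b) p₀
      = -(μ.1 + 1 / ν * (∫ u in Set.Icc a b, p₀ u * payoff V x u) + μ.2 * S) := by
    rw [diffEntropy, hp₀, integral_mul_logb_gibbs hVc hVpos hsc μ hμ]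
  rw [hent]
  set Py := ∫ u in Set.Icc a b, p u * payoff V y u
  set Px := ∫ u in Set.Icc a b, p u * payoff V x u
  set Qy := ∫ u in Set.Icc a b, p₀ u * payoff V y u
  set Qx := ∫ u in Set.Icc a b, p₀ u * payoff V x u
  set Ent := diffEntropy (Set.Icc a b) p
  -- The logarithm of `p₀` is affine in payoff and cost, and `p` and `p₀` have the same mean cost,
  -- so `μ` contributes only the constant `μ₁ + μ₂ S`.
  have key2 : Real.log 2 / ν * (Py + ν * Ent) ≤ Real.log 2 / ν * (Qy - Qx - ν * μ.1 - ν * μ.2 * S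
      + Real.log 2 * (1 / (2 * ν) * ‖y - x‖ ^ 2)) := by
    have e1 : Real.log 2 / ν * (Py + ν * Ent)
        = Real.log 2 / ν * (Py - Px) + Real.log 2 * Ent + Real.log 2 / ν * Px := by
      field_simp; ring
    have e2 : Real.log 2 / ν * (Qy - Qx - ν * μ.1 - ν * μ.2 * S
        + Real.log 2 * (1 / (2 * ν) * ‖y - x‖ ^ 2)) = Real.log 2 / ν * (Qy - Qx)
        - Real.log 2 * (μ.1 + μ.2 * S) + (Real.log 2 / ν * ‖y - x‖) ^ 2 / 2 := by
      field_simp; ring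
    have e3 : Real.log 2 * (μ.1 + 1 / ν * Px + μ.2 * S)
        = Real.log 2 * (μ.1 + μ.2 * S) + Real.log 2 / ν * Px := by
      field_simp; ring
    rw [e1, e2]
    linarith
  have key3 := le_of_mul_le_mul_left key2 (by positivity)
  have h4 : Real.log 2 * (1 / (2 * ν) * ‖y - x‖ ^ 2) ≤ 1 / (2 * ν) * ‖y - x‖ ^ 2 :=
    mul_le_of_le_one_left (by positivity) hl1
  have h5 : ν * -(μ.1 + 1 / ν * Qx + μ.2 * S) = -Qx - ν * μ.1 - ν * μ.2 * S := by
    field_simp; ring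
  rw [h5]
  linarith

/-- The finiteness of the differential entropy joins feasibility as the constraint set of
`sSup_quadratic_bounds`; stability of the optimizer is `smoothed_le`. -/
theorem smoothG_bounds (hν : 0 < ν) (hsc : ContinuousOn s (Set.Icc a b))
    (hex : ∀ l, ∃ μ : ℝ × ℝ, IsFeasible (Set.Icc a b) s S (gibbs V s ν l μ))
    (x y : EuclideanSpace ℝ (Fin M)) :
    smoothG V (Set.Icc a b) s S ν x
      = (∫ u in Set.Icc a b, optDensity V (Set.Icc a b) s S ν x u * payoff V x u)
        + ν * diffEntropy (Set.Icc a b) (optDensity V (Set.Icc a b) s S ν x)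
        - ν * Real.logb 2 (volume.real (Set.Icc a b)) ∧
    smoothG V (Set.Icc a b) s S ν x + inner ℝ (WithLp.toLp 2 (outputDist V (Set.Icc a b)
      (optDensity V (Set.Icc a b) s S ν x))) (y - x) ≤ smoothG V (Set.Icc a b) s S ν y ∧
    smoothG V (Set.Icc a b) s S ν y ≤ smoothG V (Set.Icc a b) s S ν x
      + inner ℝ (WithLp.toLp 2 (outputDist V (Set.Icc a b)
        (optDensity V (Set.Icc a b) s S ν x))) (y - x) + 1 / (2 * ν) * ‖y - x‖ ^ 2 := by
  have hset : ∀ l : EuclideanSpace ℝ (Fin M), smoothG V (Set.Icc a b) s S ν l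
      = sSup {t | ∃ p, (IsFeasible (Set.Icc a b) s S p ∧
        IntegrableOn (fun x => p x * Real.logb 2 (p x)) (Set.Icc a b)) ∧
        t = (∫ x in Set.Icc a b, p x * payoff V l x) + ν * diffEntropy (Set.Icc a b) p
          - ν * Real.logb 2 (volume.real (Set.Icc a b))} := fun l => by
    simp only [smoothG, and_assoc]
  rw [hset x, hset y]
  refine sSup_quadratic_bounds (P := fun p => IsFeasible (Set.Icc a b) s S p ∧
      IntegrableOn (fun x => p x * Real.logb 2 (p x)) (Set.Icc a b))
    (val := fun l p => (∫ x in Set.Icc a b, p x * payoff V l x)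
      + ν * diffEntropy (Set.Icc a b) p - ν * Real.logb 2 (volume.real (Set.Icc a b)))
    (opt := optDensity V (Set.Icc a b) s S ν)
    (grad := fun x => WithLp.toLp 2 (outputDist V (Set.Icc a b)
      (optDensity V (Set.Icc a b) s S ν x))) (fun x => ?_) (fun x y q hq => ?_)
    (fun x y => ?_) x y
  · obtain ⟨μ, hμ, hfe⟩ := optDensity_spec (hex x)
    rw [hμ]
    exact ⟨hfe, integrableOn_gibbs_mul_logb hVc hVpos hsc hfe.1⟩
  · obtain ⟨μ, hμ, hfe⟩ := optDensity_spec (hex x)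
    rw [hμ]
    have := smoothed_le hVc hVpos hsum hν hsc x y hfe hq.1 hq.2
    linarith
  · obtain ⟨μ, hμ, hfe⟩ := optDensity_spec (hex x)
    rw [hμ, integral_payoff_eq_add hVc hVpos hfe.1 y x]
    simp only [PiLp.inner_apply, RCLike.inner_apply, conj_trivial, PiLp.sub_apply]
    ring

theorem gradient_smoothG (hν : 0 < ν) (hsc : ContinuousOn s (Set.Icc a b))
    (hex : ∀ l, ∃ μ : ℝ × ℝ, IsFeasible (Set.Icc a b) s S (gibbs V s ν l μ))
    (x : EuclideanSpace ℝ (Fin M)) :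
    ∇ (smoothG V (Set.Icc a b) s S ν) x
      = WithLp.toLp 2 (outputDist V (Set.Icc a b) (optDensity V (Set.Icc a b) s S ν x)) :=
  (hasGradientAt_of_quadratic_bound
    (fun y => (smoothG_bounds hVc hVpos hsum hν hsc hex x y).2.1)
    fun y => (smoothG_bounds hVc hVpos hsum hν hsc hex x y).2.2).gradient

end Smoothing

/-! ### The smoothing error -/

section SmoothingError

variable {a b S ν : ℝ} {V : Fin M → ℝ → ℝ} {s : ℝ → ℝ}

/-- The cost constraint in the form that `tilt_mul_le` takes, with tilt parameter `ln 2 * μ₂`. -/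
theorem integral_tilt_eq_zero {A : Set ℝ} {l : EuclideanSpace ℝ (Fin M)} {μ : ℝ × ℝ}
    (hsi : IntegrableOn (fun x => gibbs V s ν l μ x * s x) A)
    (hμ : IsFeasible A s S (gibbs V s ν l μ)) :
    ∫ x in A, Real.exp (Real.log 2 * (1 / ν * payoff V l x) + Real.log 2 * μ.2 * (s x - S))
      * (s x - S) = 0 := by
  have h1 : ∫ x in A, gibbs V s ν l μ x * (s x - S) = 0 := by
    simp only [mul_sub]
    rw [integral_sub hsi (hμ.1.1.mul_const S), hμ.2, integral_mul_const, hμ.1.2.2, one_mul,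
      sub_self]
  simp only [gibbs_eq (S := S), mul_assoc (Real.exp (Real.log 2 * (μ.1 + μ.2 * S)))] at h1
  rw [integral_const_mul] at h1
  exact (mul_eq_zero.mp h1).resolve_left (Real.exp_pos _).ne'

theorem integral_exp_eq {A : Set ℝ} {l : EuclideanSpace ℝ (Fin M)} {μ : ℝ × ℝ}
    (hμ : IsFeasible A s S (gibbs V s ν l μ)) :
    ∫ x in A, Real.exp (Real.log 2 * (1 / ν * payoff V l x) + Real.log 2 * μ.2 * (s x - S))
      = Real.exp (-(Real.log 2 * (μ.1 + μ.2 * S))) := by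
  have h1 := hμ.1.2.2
  simp only [gibbs_eq (S := S)] at h1
  rw [integral_const_mul] at h1
  rw [Real.exp_neg]
  exact eq_inv_of_mul_eq_one_right h1

/-- One side of the bound on the multiplier of the cost constraint. -/
theorem mul_abs_le_of_tilt_bound {Lf Ls ρ d μ : ℝ} (hLs : 0 ≤ Ls) (hρ : 0 < ρ)
    (hν : 0 < ν) (hd : 0 < d)
    (h : Real.log 2 * μ * (d / 2) ≤ Real.log 2 * (1 / ν * (Lf * ρ)) + Real.log (2 * Ls * ρ / d)) :
    Ls * ρ * μ ≤ 2 * Lf * Ls * ρ ^ 2 * (1 / d) / ν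
      + Ls * ρ * (2 / d * Real.logb 2 (max (2 * Ls * ρ / d) 1)) := by
  have hl2 : 0 < Real.log 2 := Real.log_pos one_lt_two
  have h1 : Real.log (2 * Ls * ρ / d) ≤ Real.log 2 * Real.logb 2 (max (2 * Ls * ρ / d) 1) := by
    rw [Real.logb, mul_div_cancel₀ _ hl2.ne']
    -- For `Ls = 0` the logarithm on the left takes the default value `log 0 = 0`.
    rcases (show 0 ≤ 2 * Ls * ρ / d by positivity).eq_or_lt with h0 | h0
    · rw [← h0]; simp
    · exact Real.log_le_log h0 (le_max_left _ _)
  set B := Real.logb 2 (max (2 * Ls * ρ / d) 1)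
  have h2 : Real.log 2 * (μ * (d / 2)) ≤ Real.log 2 * (1 / ν * (Lf * ρ) + B) := by linarith
  have h3 := le_of_mul_le_mul_left h2 hl2
  have h4 : μ ≤ 2 / d * (1 / ν * (Lf * ρ) + B) := by
    have := mul_le_mul_of_nonneg_left h3 (show 0 ≤ 2 / d by positivity)
    have e : 2 / d * (μ * (d / 2)) = μ := by field_simp
    rwa [e] at this
  calc Ls * ρ * μ ≤ Ls * ρ * (2 / d * (1 / ν * (Lf * ρ) + B)) := by gcongr
    _ = _ := by field_simp

/-- The error caused by the entropic smoothing. -/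
theorem dualG_le_smoothG_add (hab : a < b) (hVc : ∀ i, ContinuousOn (V i) (Set.Icc a b))
    (hVpos : ∀ i, ∀ x ∈ Set.Icc a b, 0 < V i x) (hsum : ∀ x ∈ Set.Icc a b, ∑ i, V i x = 1)
    (hν : 0 < ν) {Ls : ℝ≥0} (hs : LipschitzOnWith Ls s (Set.Icc a b))
    (hS₁ : sInf (s '' Set.Icc a b) < S) (hS₂ : S < sSup (s '' Set.Icc a b))
    (hex : ∀ l, ∃ μ : ℝ × ℝ, IsFeasible (Set.Icc a b) s S (gibbs V s ν l μ))
    {l : EuclideanSpace ℝ (Fin M)} {Lf : ℝ} (hLf0 : 0 ≤ Lf)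
    (hLf : ∀ x ∈ Set.Icc a b, ∀ y ∈ Set.Icc a b, |payoff V l x - payoff V l y| ≤ Lf * |x - y|)
    {T₁ T₂ : ℝ}
    (hT₁ : T₁ = Lf * (b - a) + 2 * Lf * Ls * (b - a) ^ 2
      * max (1 / -sLow (Set.Icc a b) s S) (1 / sHigh (Set.Icc a b) s S))
    (hT₂ : T₂ = constT₂ (Set.Icc a b) s S Ls) :
    dualG V (Set.Icc a b) s S l ≤ smoothG V (Set.Icc a b) s S ν l
      + ν * Real.logb 2 (1 + Real.log 2 * (T₁ / ν + T₂)) := by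
  have hl2 : 0 < Real.log 2 := Real.log_pos one_lt_two
  have hsc := hs.continuousOn
  have hne : (Set.Icc a b).Nonempty := Set.nonempty_Icc.mpr hab.le
  have hfc : ContinuousOn (payoff V l) (Set.Icc a b) := continuousOn_payoff hVc hVpos
  have hLs : ∀ x ∈ Set.Icc a b, ∀ y ∈ Set.Icc a b, |s x - s y| ≤ Ls * |x - y| :=
    fun x hx y hy => by simpa [Real.dist_eq] using hs.dist_le_mul x hx y hy
  have hρ : 0 < b - a := by linarith
  have hdist : ∀ x ∈ Set.Icc a b, ∀ y ∈ Set.Icc a b, |x - y| ≤ b - a := fun x hx y hy =>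
    abs_le.mpr ⟨by linarith [hx.1, hy.2], by linarith [hx.2, hy.1]⟩
  obtain ⟨x₀, hx₀, hmin⟩ := isCompact_Icc.exists_sInf_image_eq hne hsc
  obtain ⟨x₁, hx₁, hmax⟩ := isCompact_Icc.exists_sSup_image_eq hne hsc
  have hlow : sLow (Set.Icc a b) s S = s x₀ - S := by rw [sLow, hmin]; ring
  have hhigh : sHigh (Set.Icc a b) s S = s x₁ - S := by rw [sHigh, hmax]; ring
  rw [hmin] at hS₁
  rw [hmax] at hS₂
  obtain ⟨μ, hopt, hμ⟩ := optDensity_spec (hex l)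
  set w : ℝ → ℝ := fun x =>
    Real.log 2 * (1 / ν * payoff V l x) + Real.log 2 * μ.2 * (s x - S) with hw
  have hwc : ContinuousOn w (Set.Icc a b) := by fun_prop
  have htilt := integral_tilt_eq_zero (hμ.1.integrableOn_mul hsc) hμ
  have hφ : ∀ x ∈ Set.Icc a b, ∀ y ∈ Set.Icc a b,
      Real.log 2 * (1 / ν * payoff V l x) - Real.log 2 * (1 / ν * payoff V l y)
        ≤ Real.log 2 * (1 / ν * (Lf * (b - a))) := fun x hx y hy => by
    rw [← mul_sub, ← mul_sub]
    gcongr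
    exact (le_abs_self _).trans ((hLf x hx y hy).trans (by gcongr; exact hdist x hx y hy))
  -- the bound on the multiplier
  have hmu : Ls * (b - a) * |μ.2| ≤ 2 * Lf * Ls * (b - a) ^ 2
      * max (1 / -sLow (Set.Icc a b) s S) (1 / sHigh (Set.Icc a b) s S) / ν + T₂ := by
    have hvol : volume.real (Set.Icc a b) = b - a := Real.volume_real_Icc_of_le hab.le
    rw [hT₂, constT₂, hvol, hlow, hhigh]
    -- A positive multiplier is limited by the point of maximal cost; a negative one by the point of
    -- minimal cost, after reflecting the centred cost.
    rcases le_total 0 μ.2 with h0 | h0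
    · have h1 := tilt_mul_le (h := fun x => Real.log 2 * (1 / ν * payoff V l x))
        (σ := fun x => s x - S) (K := Ls) (t := Real.log 2 * μ.2) hab (by fun_prop) (by fun_prop)
        hφ (fun x hx y hy => by simpa using hLs x hx y hy) hx₀ hx₁ (by linarith) (by linarith)
        (by positivity) htilt.le
      have h2 := mul_abs_le_of_tilt_bound Ls.coe_nonneg hρ hν (by linarith) h1
      rw [abs_of_nonneg h0]
      refine h2.trans ?_
      gcongr
      · exact le_max_right _ _
      · exact le_max_right _ _
    · have h1 := tilt_mul_le (h := fun x => Real.log 2 * (1 / ν * payoff V l x))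
        (σ := fun x => -(s x - S)) (K := Ls) (t := Real.log 2 * -μ.2) hab (by fun_prop)
        (by fun_prop) hφ (fun x hx y hy => by
          rw [show -(s x - S) - -(s y - S) = -(s x - s y) by ring, abs_neg]
          exact hLs x hx y hy) hx₁ hx₀ (by linarith) (by linarith)
        (mul_nonneg hl2.le (by linarith))
        (by
          simp only [mul_neg, neg_mul, neg_neg, integral_neg]
          rw [htilt, neg_zero])
      have h2 := mul_abs_le_of_tilt_bound Ls.coe_nonneg hρ hν (by linarith) h1
      rw [abs_of_nonpos h0]
      refine h2.trans ?_
      gcongr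
      · exact le_max_left _ _
      · exact le_max_left _ _
  -- A Lipschitz constant of the exponent `w`. `T₁` and `T₂` collect the parts of the bound on `K (b
  -- - a)` of order `1 / ν` and `1`.
  set K := Real.log 2 * (Lf / ν + Ls * |μ.2|) with hK
  have hK0 : 0 ≤ K := by positivity
  have hwK : ∀ x ∈ Set.Icc a b, ∀ y ∈ Set.Icc a b, |w x - w y| ≤ K * |x - y| := by
    intro x hx y hy
    have e : w x - w y = Real.log 2 * (1 / ν * (payoff V l x - payoff V l y))
        + Real.log 2 * (μ.2 * (s x - s y)) := by rw [hw]; ring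
    rw [e]
    refine (abs_add_le _ _).trans ?_
    rw [abs_mul, abs_mul, abs_mul, abs_mul, abs_of_pos hl2, abs_of_pos (one_div_pos.mpr hν)]
    calc _ ≤ Real.log 2 * (1 / ν * (Lf * |x - y|)) + Real.log 2 * (|μ.2| * (Ls * |x - y|)) := by
          gcongr
          · exact hLf x hx y hy
          · exact hLs x hx y hy
      _ = K * |x - y| := by rw [hK]; ring
  have hKρ : K * (b - a) ≤ Real.log 2 * (T₁ / ν + T₂) := by
    have e : K * (b - a) = Real.log 2 * (Lf * (b - a) / ν + Ls * (b - a) * |μ.2|) := by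
      rw [hK]; ring
    rw [e, hT₁, add_div]
    exact mul_le_mul_of_nonneg_left (by linarith) hl2.le
  obtain ⟨c, hc, hcmax⟩ := isCompact_Icc.exists_isMaxOn hne hwc
  have hlap := mul_exp_le_integral_exp hab hK0 hwc hwK hc
  rw [show ∫ x in Set.Icc a b, Real.exp (w x) = _ from integral_exp_eq hμ] at hlap
  have hlog : Real.log (b - a) + w c
      ≤ Real.log (1 + Real.log 2 * (T₁ / ν + T₂)) - Real.log 2 * (μ.1 + μ.2 * S) := by
    have hpos : 0 < 1 + K * (b - a) := by positivity
    have h1 := Real.log_le_log (by positivity) hlap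
    rw [Real.log_mul hρ.ne' (Real.exp_pos _).ne', Real.log_exp,
      Real.log_mul hpos.ne' (Real.exp_pos _).ne', Real.log_exp] at h1
    have h2 : Real.log (1 + K * (b - a)) ≤ Real.log (1 + Real.log 2 * (T₁ / ν + T₂)) :=
      Real.log_le_log hpos (by linarith)
    linarith
  -- At the optimizer the mean payoff cancels against the entropy, leaving only the normalization.
  have hGν : smoothG V (Set.Icc a b) s S ν l
      = -(ν * (μ.1 + μ.2 * S)) - ν * Real.logb 2 (b - a) := by
    rw [(smoothG_bounds hVc hVpos hsum hν hsc hex l l).1, hopt, diffEntropy,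
      integral_mul_logb_gibbs hVc hVpos hsc μ hμ, Real.volume_real_Icc_of_le hab.le]
    field_simp
    ring
  refine csSup_le ⟨_, gibbs V s ν l μ, hμ, rfl⟩ ?_
  rintro _ ⟨p, hp, rfl⟩
  -- The cost part of `w` has mean zero under every feasible density, so the scaled mean payoff is
  -- the mean of `w`, at most its maximum `w c`.
  have hpw : Real.log 2 / ν * ∫ x in Set.Icc a b, p x * payoff V l x ≤ w c := by
    have h1 := hp.1.integral_mul_le hwc hcmax
    have h2 : ∀ x, p x * w x = Real.log 2 / ν * (p x * payoff V l x)
        + Real.log 2 * μ.2 * (p x * s x - p x * S) := fun x => by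
      rw [hw]; ring
    have i1 : IntegrableOn (fun x => Real.log 2 / ν * (p x * payoff V l x)) (Set.Icc a b) :=
      (hp.1.integrableOn_mul hfc).const_mul _
    have i2 : IntegrableOn (fun x => p x * s x) (Set.Icc a b) := hp.1.integrableOn_mul hsc
    have i3 : IntegrableOn (fun x => Real.log 2 * μ.2 * (p x * s x - p x * S)) (Set.Icc a b) :=
      (i2.sub (hp.1.1.mul_const S)).const_mul _
    simp only [h2] at h1
    rw [integral_add i1 i3, integral_const_mul, integral_const_mul,
      integral_sub i2 (hp.1.1.mul_const S), hp.2, integral_mul_const, hp.1.2.2] at h1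
    linarith
  rw [hGν, Real.logb, Real.logb]
  refine le_of_mul_le_mul_left ?_ (show 0 < Real.log 2 / ν by positivity)
  refine hpw.trans ?_
  have e : Real.log 2 / ν * (-(ν * (μ.1 + μ.2 * S)) - ν * (Real.log (b - a) / Real.log 2)
      + ν * (Real.log (1 + Real.log 2 * (T₁ / ν + T₂)) / Real.log 2))
      = -(Real.log 2 * (μ.1 + μ.2 * S)) - Real.log (b - a)
        + Real.log (1 + Real.log 2 * (T₁ / ν + T₂)) := by
    have := hl2.ne'
    field_simp
  rw [e]
  linarith

end SmoothingError

/-! ### Choice of the smoothing parameter and of the number of iterations -/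

section Parameters

variable {α ε : ℝ}

theorem four_lt_div (hε : 0 < ε) (hεα : ε < α / 4) : 4 < α / ε := by
  rw [lt_div_iff₀ hε]; linarith

theorem two_lt_logb_div (hε : 0 < ε) (hεα : ε < α / 4) : 2 < Real.logb 2 (α / ε) := by
  rw [Real.lt_logb_iff_rpow_lt one_lt_two (by linarith [four_lt_div hε hεα])]
  norm_num
  exact four_lt_div hε hεα

theorem smoothing_pos (hε : 0 < ε) (hεα : ε < α / 4) : 0 < smoothing α ε := by
  have := two_lt_logb_div hε hεα
  have hα : 0 < α := by linarith
  exact div_pos (div_pos hε hα) (by linarith)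

theorem one_div_smoothing (hε : 0 < ε) (hεα : ε < α / 4) :
    1 / smoothing α ε = α / ε * Real.logb 2 (α / ε) := by
  have := two_lt_logb_div hε hεα
  have hα : 0 < α := by linarith
  have h0 : Real.logb 2 (α / ε) ≠ 0 := by linarith
  rw [smoothing]
  field_simp

theorem eight_le_one_div_smoothing (hε : 0 < ε) (hεα : ε < α / 4) : 8 ≤ 1 / smoothing α ε := by
  rw [one_div_smoothing hε hεα]
  nlinarith [two_lt_logb_div hε hεα, four_lt_div hε hεα]

/-- With `t = α / ε` and `T = T₁ + T₂`, one has `1 / ν = t log t` and `ε / 2 = ν (1 + T) log t`,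
since `α / 2 = 1 + T`. The claim becomes `1 + ln 2 (T₁ / ν + T₂) ≤ t ^ (1 + T)`; as `1 / ν ≥ 1`, the
left side is at most `t (1 + T ln t) ≤ t * t ^ T`. -/
theorem smoothing_mul_logb_le {T₁ T₂ : ℝ} (hT₁ : 0 ≤ T₁) (hT₂ : 0 ≤ T₂)
    (hα : α = 2 * (T₁ + T₂ + 1)) (hε : 0 < ε) (hεα : ε < α / 4) :
    smoothing α ε * Real.logb 2 (1 + Real.log 2 * (T₁ / smoothing α ε + T₂)) ≤ ε / 2 := by
  have hl2 : 0 < Real.log 2 := Real.log_pos one_lt_two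
  have hν := smoothing_pos hε hεα
  have h8 := eight_le_one_div_smoothing hε hεα
  have ht := four_lt_div hε hεα
  have hinv := one_div_smoothing hε hεα
  have hlogt := two_lt_logb_div hε hεα
  have hε2 : ε / 2 = smoothing α ε * ((1 + (T₁ + T₂)) * Real.logb 2 (α / ε)) := by
    have h0 : Real.logb 2 (α / ε) ≠ 0 := by linarith
    have hα0 : α ≠ 0 := by linarith
    rw [smoothing, show 1 + (T₁ + T₂) = α / 2 by rw [hα]; ring]
    field_simp
  rw [hε2]
  refine mul_le_mul_of_nonneg_left ?_ hν.le
  set ν := smoothing α ε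
  set t := α / ε
  have hmain : 1 + Real.log 2 * (T₁ / ν + T₂) ≤ Real.exp ((1 + (T₁ + T₂)) * Real.log t) := by
    have hlt : Real.log 2 * Real.logb 2 t = Real.log t := by
      rw [Real.logb, mul_div_cancel₀ _ hl2.ne']
    have h1 : Real.log 2 * (T₁ / ν + T₂) ≤ t * ((T₁ + T₂) * Real.log t) := by
      have : T₁ / ν + T₂ ≤ (T₁ + T₂) * (1 / ν) := by
        rw [div_eq_mul_one_div]
        nlinarith
      calc Real.log 2 * (T₁ / ν + T₂) ≤ Real.log 2 * ((T₁ + T₂) * (1 / ν)) := by gcongr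
        _ = _ := by rw [hinv, ← hlt]; ring
    have h2 := Real.add_one_le_exp ((T₁ + T₂) * Real.log t)
    rw [add_mul, one_mul, Real.exp_add, Real.exp_log (by linarith)]
    calc _ ≤ t * ((T₁ + T₂) * Real.log t + 1) := by linarith
      _ ≤ _ := by gcongr
  have h3 := Real.log_le_log (by positivity) hmain
  rw [Real.log_exp] at h3
  rw [Real.logb, Real.logb, ← mul_div_assoc]
  gcongr

/-- The summand `1/4` in the iteration bound absorbs the constant `1` of the step parameter, because
`1 ≤ (α / ε) / 4`. -/
theorem step_error_le {D : ℝ} (hD : 0 ≤ D) (hε : 0 < ε) (hεα : ε < α / 4) {n : ℕ}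
    (hn : iterBound D α ε ≤ n) :
    (1 + 1 / smoothing α ε) * D ≤ ((n : ℝ) + 1) * (n + 2) / 4 * (ε / 2) := by
  have hα : 0 < α := by linarith
  have ht := four_lt_div hε hεα
  have hlog : Real.logb 2 ε⁻¹ + Real.logb 2 α + 1 / 4 = Real.logb 2 (α / ε) + 1 / 4 := by
    rw [Real.logb_inv, Real.logb_div hα.ne' hε.ne']; ring
  have hlogt := two_lt_logb_div hε hεα
  rw [iterBound, hlog] at hn
  have hsq : (1 / ε * √(8 * D * α) * √(Real.logb 2 (α / ε) + 1 / 4)) ^ 2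
      = 8 * D * α * (Real.logb 2 (α / ε) + 1 / 4) / ε ^ 2 := by
    rw [mul_pow, mul_pow, Real.sq_sqrt (by positivity), Real.sq_sqrt (by linarith)]
    ring
  have hn2 : 8 * D * α * (Real.logb 2 (α / ε) + 1 / 4) / ε ^ 2 ≤ (n : ℝ) ^ 2 := by
    rw [← hsq]
    exact pow_le_pow_left₀ (by positivity) hn 2
  rw [one_div_smoothing hε hεα]
  set lt := Real.logb 2 (α / ε)
  have h1 : 8 * D * (α / ε * (lt + 1 / 4)) ≤ ε * (n : ℝ) ^ 2 := by
    have := mul_le_mul_of_nonneg_left hn2 hε.le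
    have e : ε * (8 * D * α * (lt + 1 / 4) / ε ^ 2) = 8 * D * (α / ε * (lt + 1 / 4)) := by
      field_simp
    rwa [e] at this
  have h2 : D * (1 + α / ε * lt) ≤ D * (α / ε * (lt + 1 / 4)) :=
    mul_le_mul_of_nonneg_left (by linarith) hD
  have h3 : ε * (n : ℝ) ^ 2 ≤ ε * (((n : ℝ) + 1) * (n + 2)) := by
    have : (0 : ℝ) ≤ n := Nat.cast_nonneg n
    refine mul_le_mul_of_nonneg_left ?_ hε.le
    nlinarith
  linarith

/-- The radius of the multiplier of the output distribution and the error of the starting point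
fit into `D₁`. -/
theorem start_error_le {A : Set ℝ} {V : Fin M → ℝ → ℝ} (hγ : 0 < minProb V A)
    (hV : ∀ i, ∀ x ∈ A, minProb V A ≤ V i x) (hsum : ∀ x ∈ A, ∑ i, V i x = 1) (hA : A.Nonempty)
    {L : ℝ} (hL : 9 ≤ L) :
    L / 2 * (M * Real.logb 2 (minProb V A)⁻¹ ^ 2) + (dualRadius V A + 1 / (2 * L))
      ≤ L * constD₁ V A := by
  have hm1 := one_le_one_div_log_two
  have hm2 := one_div_log_two_le
  have hLinv : 1 / (2 * L) ≤ 1 := by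
    rw [div_le_one (by linarith)]; linarith
  unfold dualRadius constD₁
  rcases logb_inv_minProb_cases hγ hV hsum hA with ⟨hM1, h0⟩ | ⟨hM2, h1⟩
  · rw [h0, hM1]
    have e : max 0 (1 / Real.log 2) = 1 / Real.log 2 := max_eq_right (by linarith)
    simp only [Nat.cast_one, one_mul, mul_zero, e]
    generalize 1 / Real.log 2 = m at *
    nlinarith [mul_le_mul hL hm1 (by linarith) (by linarith)]
  -- `D₁` allows `(M ℓ)²` where the multiplier needs only `M ℓ²`. The slack is at least `M ℓ`, and
  -- `L / 2 ≥ 9 / 2` times it exceeds `2 M ℓ + 1`, which bounds the starting error.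
  · generalize Real.logb 2 (minProb V A)⁻¹ = ℓ at *
    have h2 : max ℓ (1 / Real.log 2) ≤ 2 * ℓ := max_le (by linarith) (by linarith)
    have h3 : (M * ℓ) ^ 2 ≤ (max (M * ℓ) (1 / Real.log 2)) ^ 2 :=
      pow_le_pow_left₀ (by positivity) (le_max_left _ _) 2
    have h4 : (M : ℝ) * max ℓ (1 / Real.log 2) ≤ M * (2 * ℓ) := by gcongr
    have h5 : 2 ≤ M * ℓ := by nlinarith
    have h6 : (M : ℝ) * ℓ ≤ (M * ℓ) ^ 2 - M * ℓ ^ 2 := by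
      have : 0 ≤ (M * ℓ) * ((M - 1) * ℓ - 1) := by
        refine mul_nonneg (by linarith) ?_
        nlinarith
      nlinarith
    have h7 : 9 * (M * ℓ) ≤ L * ((M * ℓ) ^ 2 - M * ℓ ^ 2) :=
      mul_le_mul hL h6 (by linarith) (by linarith)
    have h8 := mul_le_mul_of_nonneg_left h3 (show 0 ≤ L by linarith)
    linarith

/-- Near `0` the constants `log α + 1/4` are dominated by `log (1 / ε)`, and the comparison function
is at least `1`, which absorbs the rounding. -/
theorem iterBound_isBigO (D α : ℝ) :
    (fun ε => ((⌈iterBound D α ε⌉₊ : ℕ) : ℝ)) =O[𝓝[>] 0]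
      fun ε => (1 / ε) * √(Real.logb 2 ε⁻¹) := by
  set K := √(8 * D * α) with hK
  set B := |Real.logb 2 α| + 1 with hB
  refine IsBigO.of_bound (K * √2 + 1) ?_
  have hlim : Filter.Tendsto (fun ε : ℝ => Real.logb 2 ε⁻¹) (𝓝[>] 0) Filter.atTop :=
    (Real.tendsto_logb_atTop one_lt_two).comp tendsto_inv_nhdsGT_zero
  filter_upwards [hlim.eventually_ge_atTop B, self_mem_nhdsWithin,
    Ioo_mem_nhdsGT (one_pos : (0 : ℝ) < 1)] with ε hlog hε hε1
  have hε0 : 0 < ε := hε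
  have hB1 : 1 ≤ B := by rw [hB]; linarith [abs_nonneg (Real.logb 2 α)]
  have hinv : 1 ≤ 1 / ε := by
    rw [le_div_iff₀ hε0]; linarith [hε1.2]
  have hbound0 : 0 ≤ iterBound D α ε := by unfold iterBound; positivity
  have h1 : √(Real.logb 2 ε⁻¹ + Real.logb 2 α + 1 / 4) ≤ √2 * √(Real.logb 2 ε⁻¹) := by
    rw [← Real.sqrt_mul zero_le_two]
    refine Real.sqrt_le_sqrt ?_
    linarith [le_abs_self (Real.logb 2 α)]
  have h2 : 1 ≤ √(Real.logb 2 ε⁻¹) := Real.one_le_sqrt.mpr (hB1.trans hlog)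
  have h3 : 1 ≤ 1 / ε * √(Real.logb 2 ε⁻¹) := one_le_mul_of_one_le_of_one_le hinv h2
  rw [Real.norm_of_nonneg (Nat.cast_nonneg _), Real.norm_of_nonneg (by positivity)]
  have h4 : iterBound D α ε ≤ K * √2 * (1 / ε * √(Real.logb 2 ε⁻¹)) := by
    calc iterBound D α ε ≤ 1 / ε * K * (√2 * √(Real.logb 2 ε⁻¹)) := by
          unfold iterBound
          gcongr
      _ = _ := by ring
  have h5 := (Nat.ceil_lt_add_one hbound0).le
  linarith

end Parameters

/-! ### The averaged primal density -/

section Averaging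

variable {a b S ν : ℝ} {V : Fin M → ℝ → ℝ} {s : ℝ → ℝ} {x₀ : EuclideanSpace ℝ (Fin M)}

theorem isFeasible_optDensity {A : Set ℝ} {l : EuclideanSpace ℝ (Fin M)}
    (hex : ∃ μ : ℝ × ℝ, IsFeasible A s S (gibbs V s ν l μ)) :
    IsFeasible A s S (optDensity V A s S ν l) := by
  obtain ⟨μ, hopt, hμ⟩ := optDensity_spec hex
  rwa [hopt]

theorem sum_weights (n : ℕ) :
    ∑ k ∈ Finset.range (n + 1), 2 * ((k : ℝ) + 1) / (((n : ℝ) + 1) * ((n : ℝ) + 2)) = 1 := by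
  rw [← Finset.sum_div, div_eq_one_iff_eq (by positivity)]
  induction n with
  | zero => norm_num
  | succ n ih =>
    rw [Finset.sum_range_succ, ih]
    push_cast
    ring

variable (hex : ∀ l, ∃ μ : ℝ × ℝ, IsFeasible (Set.Icc a b) s S (gibbs V s ν l μ))
include hex

theorem integral_primalApprox_mul (n : ℕ) {k : ℝ → ℝ} (hk : ContinuousOn k (Set.Icc a b)) :
    ∫ x in Set.Icc a b, primalApprox V (Set.Icc a b) s S ν x₀ n x * k x
      = ∑ j ∈ Finset.range (n + 1), 2 * ((j : ℝ) + 1) / (((n : ℝ) + 1) * ((n : ℝ) + 2)) *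
        ∫ x in Set.Icc a b, optDensity V (Set.Icc a b) s S ν
          (iterX V (Set.Icc a b) s S ν x₀ j) x * k x := by
  simp only [primalApprox, Finset.sum_mul, mul_assoc]
  rw [integral_finsetSum]
  · exact Finset.sum_congr rfl fun j _ => integral_const_mul _ _
  · exact fun j _ => ((isFeasible_optDensity (hex _)).1.integrableOn_mul hk).const_mul _

theorem isFeasible_primalApprox (hsc : ContinuousOn s (Set.Icc a b)) (n : ℕ) :
    IsFeasible (Set.Icc a b) s S (primalApprox V (Set.Icc a b) s S ν x₀ n) := by
  have hopt : ∀ j, IsFeasible (Set.Icc a b) s S (optDensity V (Set.Icc a b) s S ν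
      (iterX V (Set.Icc a b) s S ν x₀ j)) := fun j => isFeasible_optDensity (hex _)
  refine ⟨⟨?_, ?_, ?_⟩, ?_⟩
  · exact integrable_finsetSum _ fun j _ => (hopt j).1.1.const_mul _
  · have : ∀ᵐ x ∂(volume.restrict (Set.Icc a b)), ∀ j, 0 ≤ optDensity V (Set.Icc a b) s S ν
        (iterX V (Set.Icc a b) s S ν x₀ j) x := ae_all_iff.mpr fun j => (hopt j).1.2.1
    filter_upwards [this] with x hx
    exact Finset.sum_nonneg fun j _ => mul_nonneg (by positivity) (hx j)
  · have := integral_primalApprox_mul (x₀ := x₀) hex n (k := fun _ => 1) continuousOn_const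
    simp only [mul_one, (hopt _).1.2.2, sum_weights] at this
    exact this
  · rw [integral_primalApprox_mul hex n hsc]
    simp only [(hopt _).2]
    rw [← Finset.sum_mul, sum_weights, one_mul]

end Averaging

/-! ### Comparison at `-log q` and the final estimate -/

/-- The multiplier given by the negative logarithm of an output distribution. -/
theorem norm_sq_neg_logb_le {γ : ℝ} (hγ : 0 < γ) {q : Fin M → ℝ}
    (hq : q ∈ stdSimplex ℝ (Fin M)) (hγq : ∀ i, γ ≤ q i) :
    ‖(WithLp.toLp 2 fun i => -Real.logb 2 (q i) : EuclideanSpace ℝ (Fin M))‖ ^ 2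
      ≤ M * Real.logb 2 γ⁻¹ ^ 2 := by
  rw [EuclideanSpace.real_norm_sq_eq]
  calc _ ≤ ∑ _i : Fin M, Real.logb 2 γ⁻¹ ^ 2 := Finset.sum_le_sum fun i _ => by
        change (-Real.logb 2 (q i)) ^ 2 ≤ _
        have h1 := Real.logb_le_logb_of_le one_lt_two hγ (hγq i)
        have h2 := Real.logb_nonpos one_lt_two (hq.1 i) (stdSimplex_le_one hq i)
        rw [Real.logb_inv]
        exact pow_le_pow_left₀ (by linarith) (by linarith) 2
    _ = _ := by simp

/-- For the multiplier `-log q`, the linearization of `F` is nonpositive. -/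
theorem dualF_add_inner_le (hM : 0 < M) {q : Fin M → ℝ} (hq : q ∈ stdSimplex ℝ (Fin M))
    (hpos : ∀ i, 0 < q i) (x : EuclideanSpace ℝ (Fin M)) :
    dualF x + inner ℝ (-WithLp.toLp 2 (softmin x))
      ((WithLp.toLp 2 fun i => -Real.logb 2 (q i)) - x) ≤ 0 := by
  have hl2 : 0 < Real.log 2 := Real.log_pos one_lt_two
  -- Nonnegativity of the relative entropy of `softmin x` to `q`; the linearization is minus this
  -- quantity, in bits.
  have h1 := sum_mul_le_add_relEntropy (h := fun _ => 0) (B := 0) hq hpos (softmin_mem hM x)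
    le_rfl (by simp)
  simp only [mul_zero, Finset.sum_const_zero] at h1
  rw [(dualF_bounds hM x x).1, inner_neg_left, inner_sub_right, entropy_eq]
  simp only [PiLp.inner_apply, RCLike.inner_apply, conj_trivial]
  have h2 : ∑ i, -Real.logb 2 (q i) * softmin x i
      = -(∑ i, softmin x i * Real.log (q i)) / Real.log 2 := by
    rw [neg_div, Finset.sum_div, ← Finset.sum_neg_distrib]
    exact Finset.sum_congr rfl fun i _ => by rw [Real.logb]; ring
  rw [h2]
  have h3 : -(∑ i, softmin x i * Real.log (softmin x i)) / Real.log 2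
      ≤ -(∑ i, softmin x i * Real.log (q i)) / Real.log 2 :=
    div_le_div_of_nonneg_right (by linarith) hl2.le
  linarith

theorem isEpsSolution_of_iterBound_le {X : Set ℝ} {W : ℕ → ℝ → ℝ} (hW : IsChannel X W)
    {L : ℝ≥0} (hL : ∀ i, LipschitzOnWith L (W i) X)
    {a b : ℝ} (hab : a < b) (hAX : Set.Icc a b ⊆ X)
    (hγ : 0 < minProb (truncate W M) (Set.Icc a b))
    {s : ℝ → ℝ} {Ls : ℝ≥0} (hs : LipschitzOnWith Ls s (Set.Icc a b))
    {S : ℝ} (hS₁ : sInf (s '' Set.Icc a b) < S) (hS₂ : S < sSup (s '' Set.Icc a b))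
    (hex : ∀ ν : ℝ, 0 < ν → ∀ l, ∃ μ : ℝ × ℝ,
      IsFeasible (Set.Icc a b) s S (gibbs (truncate W M) s ν l μ))
    {α ε : ℝ} (hα : α = constα (truncate W M) (Set.Icc a b) s S L Ls)
    (hε : 0 < ε) (hεα : ε < α / 4) {n : ℕ}
    (hn : iterBound (constD₁ (truncate W M) (Set.Icc a b)) α ε ≤ n)
    {x₀ : EuclideanSpace ℝ (Fin M)} (hx₀ : x₀ ∈ dualSet (truncate W M) (Set.Icc a b)) :
    IsEpsSolution (truncate W M) (Set.Icc a b) s S ε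
      (dualApprox (truncate W M) (Set.Icc a b) s S (smoothing α ε) x₀ n)
      (primalApprox (truncate W M) (Set.Icc a b) s S (smoothing α ε) x₀ n) := by
  have hM := pos_of_minProb_pos hγ
  have hA : (Set.Icc a b).Nonempty := Set.nonempty_Icc.mpr hab.le
  have hV : ∀ i, ∀ x ∈ Set.Icc a b, minProb (truncate W M) (Set.Icc a b) ≤ truncate W M i x :=
    fun i x hx => minProb_truncate_le hW hAX hx i
  have hVpos : ∀ i, ∀ x ∈ Set.Icc a b, 0 < truncate W M i x := fun i x hx =>
    hγ.trans_le (hV i x hx)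
  have hsum : ∀ x ∈ Set.Icc a b, ∑ i, truncate W M i x = 1 := fun x hx =>
    sum_truncate hM hW (hAX hx)
  have hVc : ∀ i, ContinuousOn (truncate W M i) (Set.Icc a b) := fun i =>
    (continuousOn_truncate hW hL i).mono hAX
  have hlip : ∀ l ∈ dualSet (truncate W M) (Set.Icc a b), ∀ x ∈ Set.Icc a b, ∀ y ∈ Set.Icc a b,
      |payoff (truncate W M) l x - payoff (truncate W M) l y|
        ≤ constLf (truncate W M) (Set.Icc a b) L * |x - y| := fun l hl x hx y hy =>
    abs_payoff_sub_le hW hL hAX hγ hl hx hy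
  have hsc := hs.continuousOn
  set V := truncate W M with hVdef
  set A := Set.Icc a b with hAdef
  set γ := minProb V A with hγdef
  have hν := smoothing_pos hε hεα
  have h8 := eight_le_one_div_smoothing hε hεα
  have hvol : volume.real A = b - a := Real.volume_real_Icc_of_le hab.le
  have hm1 := one_le_one_div_log_two
  have hR : 0 ≤ dualRadius V A :=
    mul_nonneg (Nat.cast_nonneg M) (le_max_of_le_right (by linarith))
  have hT₂ : 0 ≤ constT₂ A s S Ls := by
    unfold constT₂
    refine mul_nonneg (by positivity) (le_max_of_le_right (mul_nonneg ?_ ?_))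
    · rw [sHigh]
      exact div_nonneg zero_le_two (by linarith)
    · exact Real.logb_nonneg one_lt_two (le_max_right _ _)
  have hLf0 : 0 ≤ constLf V A L := by
    unfold constLf
    have : 0 ≤ max (Real.logb 2 (minProb V A)⁻¹) (1 / Real.log 2) :=
      le_max_of_le_right (by linarith)
    positivity
  have hT₁ : 0 ≤ constT₁ V A s S L Ls := by
    unfold constT₁
    have : 0 ≤ max (1 / -sLow A s S) (1 / sHigh A s S) :=
      le_max_of_le_right (div_nonneg zero_le_one (by rw [sHigh]; linarith))
    positivity
  have hsmooth := smoothing_mul_logb_le hT₁ hT₂ hα hε hεα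
  set ν := smoothing α ε with hνdef
  have hexν := hex ν hν
  set g : EuclideanSpace ℝ (Fin M) → EuclideanSpace ℝ (Fin M) :=
    fun l => ∇ dualF l + ∇ (smoothG V A s S ν) l with hg
  have hgF : ∀ l : EuclideanSpace ℝ (Fin M), ∇ dualF l = -WithLp.toLp 2 (softmin l) :=
    gradient_dualF hM
  have hgG : ∀ l, ∇ (smoothG V A s S ν) l
      = WithLp.toLp 2 (outputDist V A (optDensity V A s S ν l)) :=
    gradient_smoothG hVc hVpos hsum hν hsc hexν
  set y := dualApprox V A s S ν x₀ n with hy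
  set p := primalApprox V A s S ν x₀ n with hp
  have hyQ : y ∈ dualSet V A := norm_ballProj_le hR _
  have hpf : IsFeasible A s S p := isFeasible_primalApprox hexν hsc n
  have hweak : ∀ {p' : ℝ → ℝ}, IsFeasible A s S p' → ∀ l,
      mutualInfo V A p' ≤ dualF l + dualG V A s S l := fun hp' l =>
    mutualInfo_le hVc hVpos hsum hM hγ hV hp' l
  -- the multiplier of the output distribution
  set q := outputDist V A p with hq
  have hqmem : q ∈ stdSimplex ℝ (Fin M) := outputDist_mem hVc hVpos hsum hpf.1
  have hγq : ∀ i, γ ≤ q i := le_outputDist hVc hpf.1 hV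
  -- The comparison point depends on the final average. This is legitimate because the estimate for
  -- the method holds simultaneously for all points of the ball.
  set u : EuclideanSpace ℝ (Fin M) := WithLp.toLp 2 fun i => -Real.logb 2 (q i) with hu
  have husq : ‖u‖ ^ 2 ≤ M * Real.logb 2 γ⁻¹ ^ 2 := norm_sq_neg_logb_le hγ hqmem hγq
  have hM1 : (1 : ℝ) ≤ M := by exact_mod_cast hM
  have huQ : ‖u‖ ≤ dualRadius V A := by
    refine abs_le_of_sq_le_sq' (husq.trans ?_) hR |>.2
    have hℓ0 : 0 ≤ Real.logb 2 γ⁻¹ := by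
      rcases logb_inv_minProb_cases hγ hV hsum hA with h | h <;> linarith [h.2]
    rw [dualRadius, mul_pow]
    gcongr
    · nlinarith
    · exact le_max_left _ _
  -- the estimate for the fast gradient method
  have hlow : ∀ l l', dualF l + smoothG V A s S ν l + inner ℝ (g l) (l' - l)
      ≤ dualF l' + smoothG V A s S ν l' := fun l l' => by
    have h1 := (dualF_bounds hM l l').2.1
    have h2 := (smoothG_bounds hVc hVpos hsum hν hsc hexν l l').2.1
    simp only [hg, hgF, hgG, inner_add_left]
    linarith
  have hup : ∀ l l', dualF l' + smoothG V A s S ν l' ≤ dualF l + smoothG V A s S ν l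
      + inner ℝ (g l) (l' - l) + (1 + 1 / ν) / 2 * ‖l' - l‖ ^ 2 := fun l l' => by
    have h1 := (dualF_bounds hM l l').2.2
    have h2 := (smoothG_bounds hVc hVpos hsum hν hsc hexν l l').2.2
    simp only [hg, hgF, hgG, inner_add_left]
    have e : (1 + 1 / ν) / 2 * ‖l' - l‖ ^ 2
        = 1 / 2 * ‖l' - l‖ ^ 2 + 1 / (2 * ν) * ‖l' - l‖ ^ 2 := by field_simp
    linarith
  -- The gradient is a difference of two probability vectors, each of norm at most `1`.
  have hgnorm : ∀ l, ‖g l‖ ≤ 2 := fun l => by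
    simp only [hg, hgF, hgG]
    refine (norm_add_le _ _).trans ?_
    rw [norm_neg]
    have h1 := norm_toLp_le_one (softmin_mem hM l)
    have h2 := norm_toLp_le_one (outputDist_mem hVc hVpos hsum
      (isFeasible_optDensity (hexν l)).1)
    linarith
  have hLpos : 0 < 1 + 1 / ν := by linarith
  have hE : 1 / 2 * inner ℝ (g x₀) x₀ + ‖g x₀‖ ^ 2 / (8 * (1 + 1 / ν))
      ≤ dualRadius V A + 1 / (2 * (1 + 1 / ν)) := by
    have hx₀' : ‖x₀‖ ≤ dualRadius V A := hx₀
    have h1 : inner ℝ (g x₀) x₀ ≤ 2 * dualRadius V A :=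
      (real_inner_le_norm _ _).trans (mul_le_mul (hgnorm x₀) hx₀' (norm_nonneg _) zero_le_two)
    have h2 : ‖g x₀‖ ^ 2 / (8 * (1 + 1 / ν)) ≤ 2 ^ 2 / (8 * (1 + 1 / ν)) := by
      gcongr
      exact hgnorm x₀
    have h3 : (2 : ℝ) ^ 2 / (8 * (1 + 1 / ν)) = 1 / (2 * (1 + 1 / ν)) := by field_simp; norm_num
    linarith
  have hest := fastGradient_estimate (f := fun l => dualF l + smoothG V A s S ν l) hR hLpos hx₀
    hlow hup hE n huQ
  have hdrop : 0 ≤ (1 + 1 / ν) / 2 * ‖u - ballProj (dualRadius V A)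
      (-(1 / (1 + 1 / ν)) • (fastGradient (dualRadius V A) (1 + 1 / ν) g x₀ (n + 1)).2)‖ ^ 2 := by
    positivity
  -- the linearizations are at most the payoff of the optimizers
  have hlin : ∀ l, dualF l + smoothG V A s S ν l + inner ℝ (g l) (u - l)
      ≤ ∫ x in A, optDensity V A s S ν l x * payoff V u x := fun l => by
    have h1 := dualF_add_inner_le hM hqmem (fun i => hγ.trans_le (hγq i)) l
    obtain ⟨μ, hopt, hμ⟩ := optDensity_spec (hexν l)
    -- The entropic part of `G_ν`, including `-ν log ρ`, is nonpositive and can be dropped.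
    have h2 := diffEntropy_le hab hμ.1 (integrableOn_gibbs_mul_logb hVc hVpos hsc hμ.1)
    have h3 := (smoothG_bounds hVc hVpos hsum hν hsc hexν l l).1
    have h4 := integral_payoff_eq_add hVc hVpos (isFeasible_optDensity (hexν l)).1 u l
    have h5 : inner ℝ (WithLp.toLp 2 (outputDist V A (optDensity V A s S ν l))) (u - l)
        = ∑ i, (u i - l i) * outputDist V A (optDensity V A s S ν l) i := by
      simp only [PiLp.inner_apply, RCLike.inner_apply, conj_trivial, PiLp.sub_apply]
    rw [← hopt] at h2
    have h6 := mul_le_mul_of_nonneg_left h2 hν.le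
    simp only [hg, hgF, hgG, inner_add_left]
    rw [h5]
    linarith
  have hAn : 0 < ((n : ℝ) + 1) * (n + 2) / 4 := by positivity
  -- The averaging weights are the weights of the method divided by their sum, and `u` comes from
  -- the output of `p` itself, so the weighted payoffs add up to the mutual information.
  have hI : ((n : ℝ) + 1) * (n + 2) / 4 * mutualInfo V A p
      = ∑ k ∈ Finset.range (n + 1), ((k : ℝ) + 1) / 2 *
        ∫ x in A, optDensity V A s S ν (iterX V A s S ν x₀ k) x * payoff V u x := by
    rw [mutualInfo_eq hVpos fun i => hγ.trans_le (hγq i),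
      integral_primalApprox_mul hexν n (continuousOn_payoff hVc hVpos), Finset.mul_sum]
    refine Finset.sum_congr rfl fun k _ => ?_
    rw [← mul_assoc]
    congr 1
    field_simp
    norm_num
  have hsumle : ∑ k ∈ Finset.range (n + 1), ((k : ℝ) + 1) / 2 *
      ((dualF (iterX V A s S ν x₀ k) + smoothG V A s S ν (iterX V A s S ν x₀ k))
        + inner ℝ (g (iterX V A s S ν x₀ k)) (u - iterX V A s S ν x₀ k))
      ≤ ((n : ℝ) + 1) * (n + 2) / 4 * mutualInfo V A p := by
    rw [hI]
    exact Finset.sum_le_sum fun k _ => mul_le_mul_of_nonneg_left (hlin _) (by positivity)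
  have hstart := start_error_le hγ hV hsum hA (L := 1 + 1 / ν) (by linarith)
  have hD0 : 0 ≤ constD₁ V A := by unfold constD₁; positivity
  have hstep := step_error_le hD0 hε hεα hn
  have hgrad : dualF y + smoothG V A s S ν y ≤ mutualInfo V A p + ε / 2 := by
    refine le_of_mul_le_mul_left ?_ hAn
    have h1 : (1 + 1 / ν) / 2 * ‖u‖ ^ 2 ≤ (1 + 1 / ν) / 2 * (M * Real.logb 2 γ⁻¹ ^ 2) := by gcongr
    change ((n : ℝ) + 1) * (n + 2) / 4 * (dualF y + smoothG V A s S ν y) + _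
      ≤ _ + ∑ k ∈ Finset.range (n + 1), ((k : ℝ) + 1) / 2 *
      ((dualF (iterX V A s S ν x₀ k) + smoothG V A s S ν (iterX V A s S ν x₀ k))
        + inner ℝ (g (iterX V A s S ν x₀ k)) (u - iterX V A s S ν x₀ k)) + _ at hest
    linarith
  have hG : dualG V A s S y ≤ smoothG V A s S ν y + ε / 2 := by
    have := dualG_le_smoothG_add hab hVc hVpos hsum hν hs hS₁ hS₂ hexν hLf0 (hlip y hyQ)
      (T₁ := constT₁ V A s S L Ls) (by rw [constT₁, hvol]) rfl
    linarith
  -- The two halves of `ε` are the optimization error and the smoothing error; weak duality turns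
  -- the gap into the remaining claims.
  have hgap : dualF y + dualG V A s S y ≤ mutualInfo V A p + ε := by linarith
  refine ⟨hyQ, hpf, ?_, ?_, fun l' => ?_, fun p' hp' => ?_⟩
  · linarith [hweak hpf y]
  · linarith
  · linarith [hweak hpf l']
  · linarith [hweak hp' y]

end ChannelCapacity

open ChannelCapacity
theorem mainTheorem11 {X : Set ℝ} {W : ℕ → ℝ → ℝ} (hW : IsChannel X W)
    {L : ℝ≥0} (hL : ∀ i, LipschitzOnWith L (W i) X)
    {a b : ℝ} (hab : a < b) (hAX : Set.Icc a b ⊆ X)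
    {M : ℕ} (hγ : 0 < minProb (truncate W M) (Set.Icc a b))
    {s : ℝ → ℝ} {Ls : ℝ≥0} (hs : LipschitzOnWith Ls s X)
    {S : ℝ} (hS₁ : sInf (s '' Set.Icc a b) < S) (hS₂ : S < sSup (s '' Set.Icc a b)) :
    let A : Set ℝ := Set.Icc a b
    let V : Fin M → ℝ → ℝ := truncate W M
    let α : ℝ := constα V A s S L Ls
    let D₁ : ℝ := constD₁ V A
    -- the analytical optimizers exist
    (∀ ν : ℝ, 0 < ν → ∀ l, ∃ μ : ℝ × ℝ, IsFeasible A s S (gibbs V s ν l μ)) ∧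
    -- the a priori bound
    (∀ ε : ℝ, 0 < ε → ε < α / 4 → ∀ n : ℕ, iterBound D₁ α ε ≤ n →
      ∀ x₀ ∈ dualSet V A,
        IsEpsSolution V A s S ε
          (dualApprox V A s S (smoothing α ε) x₀ n)
          (primalApprox V A s S (smoothing α ε) x₀ n)) ∧
    -- the complexity
    ∃ N : ℝ → ℕ,
      ((fun ε => (N ε : ℝ)) =O[𝓝[>] 0] fun ε => (1 / ε) * √(Real.logb 2 ε⁻¹)) ∧
      ∀ ε : ℝ, 0 < ε → ε < α / 4 → ∀ x₀ ∈ dualSet V A,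
        IsEpsSolution V A s S ε
          (dualApprox V A s S (smoothing α ε) x₀ (N ε))
          (primalApprox V A s S (smoothing α ε) x₀ (N ε)) := by
  intro A V α D₁
  have hVc : ∀ i, ContinuousOn (V i) A := fun i => (continuousOn_truncate hW hL i).mono hAX
  have hVpos : ∀ i, ∀ x ∈ A, 0 < V i x := fun i x hx =>
    hγ.trans_le (minProb_truncate_le hW hAX hx i)
  have hex : ∀ ν : ℝ, 0 < ν → ∀ l, ∃ μ : ℝ × ℝ, IsFeasible A s S (gibbs V s ν l μ) :=
    fun ν _ l => exists_isFeasible_gibbs hab (continuousOn_payoff hVc hVpos) (hs.mono hAX) hS₁ hS₂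
  have hmain : ∀ ε : ℝ, 0 < ε → ε < α / 4 → ∀ n : ℕ, iterBound D₁ α ε ≤ n →
      ∀ x₀ ∈ dualSet V A, IsEpsSolution V A s S ε
        (dualApprox V A s S (smoothing α ε) x₀ n)
        (primalApprox V A s S (smoothing α ε) x₀ n) := fun ε hε hεα n hn x₀ hx₀ =>
    isEpsSolution_of_iterBound_le hW hL hab hAX hγ (hs.mono hAX) hS₁ hS₂ hex rfl hε hεα hn hx₀
  exact ⟨hex, hmain, fun ε => ⌈iterBound D₁ α ε⌉₊, iterBound_isBigO D₁ α,
    fun ε hε hεα x₀ hx₀ => hmain ε hε hεα _ (Nat.le_ceil _) x₀ hx₀⟩
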